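/- **Model (CSBM-OOD).** Let $C\ge 2$ be the number of classes, $\sigma>0$, and $D=2d$. Each environment $e$ (a training environment $e^{\rm tr}$ and test environments $e^{\rm te}\in\mathcal E_{\rm te}$) is a finite graph with node set $V_e$, without isolated nodes; nodes of class $c$ have feature mean $[\mu_c;\mu_c^e]\in\mathbb R^{D}$, where $(\mu_c)_c$ (invariant) and, for each $e$, $(\mu^e_c)_c$ (spurious) are orthonormal families in $\mathbb R^{d}$. The aggregated feature $g_i$ of node $i$ is the mean of the features of its neighbours. Node $i$ has a homophilic ratio $p^{\rm hm}_i\ge 0$ and heterophilic ratios $p^{\rm ht}_i(c'|c)\ge 0$ for $c'\ne c$ (ratio of neighbours of class $c'$ when $y_i=c$), with $p_i^{\rm hm}+\sum_{c'\neq c}p_i^{\rm ht}(c'|c)=1$ for each $c$. Given $y_i=c$, the aggregated feature $g_i$ is $\mathcal N\big(p_i^{\rm hm}[\mu_c;\mu_c^e]+\sum_{c'\ne c}p_i^{\rm ht}(c'|c)[\mu_{c'};\mu_{c'}^e],\,\sigma^2 I_D\big)$, and the classes have equal prior probability. Given the aggregated features, the labels are independent with $\Pr(y_i=c\mid g_i)$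 given by Bayes' rule. **Classifiers.** $\mathcal H$ is the class of ReLU multilayer perceptrons $h$ without biases, with $L$ layers of weight matrices $W_1,\dots,W_L$, a fixed architecture with at least one hidden layer, and largest hidden width $b\ge1$; $h_i=h(g_i)\in\mathbb R^C$ and $T_h=\max_l\|W_l\|_2$. The empirical margin loss is $\widehat{\mathcal L}^\gamma_e(h)=\frac1{|V_e|}\sum_{i\in V_e}\mathbf 1\big[h_i[y_i]\le\gamma+\max_{c\ne y_i}h_i[c]\big]$, and $\mathcal L^\gamma_e(h)$ is its expectation over the labels given the aggregated features. **Notation.** For a test environment $e^{\rm te}$ put $N=|V_{e^{\rm tr}}|$, $\epsilon=\max_{j\in V_{e^{\rm te}}}\min_{i\in V_{e^{\rm tr}}}\|g_i-g_j\|_2$, $B=\max_{i\in V_{e^{\rm tr}}\cup V_{e^{\rm te}}}\|g_i\|_2>0$, and, for $i\in V_{e^{\rm tr}}$, $V^{(i)}=\{j\in V_{e^{\rm te}}:\|g_i-g_j\|_2\le\epsilon\}$. Let $$\mathrm{(a)}=\frac1{\sigma^2}\sum_{c}\sum_{c'\ne c}\Big(\sqrt{\big\|[\mu_c-\mu_{c'};\mu_c^{e^{\rm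 te}}-\mu_{c'}^{e^{\rm te}}]\big\|}+2\sqrt2\Big)\epsilon,\qquad \mathrm{(b)}=\frac{2}{\sigma^2}\sum_c (C-1)B\,\|\mu_c^{e^{\rm te}}-\mu_c^{e^{\rm tr}}\|,$$ $$\mathrm{(c)}=\frac1{2\sigma^2}\frac1{N}\sum_{i\in V_{e^{\rm tr}}}\frac1{s}\sum_{j\in V^{(i)}}\sum_c\sum_{c'\ne c}\big|p^{\rm ht}_j(c'|c)-p^{\rm ht}_i(c'|c)\big|,\qquad \mathrm{(d)}_h=\frac{b\sum_{l}\|W_l\|_F^2}{(\gamma/8)^{2/L}N^{\alpha}}\,\epsilon^{2/L},$$ $$\mathrm{const}=\frac1{N^{1-2\alpha}}+\frac1{N^{2\alpha}}\ln\frac{LC(2B)^{1/L}}{\gamma^{1/L}\delta}.$$ **Assumption 2.** The sets $V^{(i)}$, $i\in V_{e^{\rm tr}}$, are pairwise disjoint and have the same size $s\ge1$. **Assumption 3** (for $\gamma>0$, $0<\alpha<\frac14$, constants $H\ge0$ and $0<\kappa\le1$). Let $\bar v=\dfrac{(\gamma/8\epsilon)^{2/L}}{2b\,(\lambda N^{-\alpha}+\ln(2bL))}$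 with $\lambda=N^{2\alpha}$. For some $v\in[\kappa\bar v,\bar v]$, if $P$ is the law of $h$ when all weights are independent $\mathcal N(0,v)$, then $$\Pr_{h\sim P}\Big(\mathcal L^{\gamma/4}_{e^{\rm te}}(h)-\mathcal L^{\gamma/2}_{e^{\rm tr}}(h)>N^{-\alpha}+HC\epsilon\ \Big|\ T_h^L\epsilon>\tfrac\gamma8\Big)\le e^{-N^{2\alpha}}$$ (the assumption is void when $\epsilon=0$). **Theorem.** For all $C\ge2$, $\sigma>0$, $B>0$, $H\ge0$, $\kappa\in(0,1]$ there is a constant $K>0$, depending only on these, such that the following holds for every $d$, every architecture and every $\gamma>0$. 1. (Expected loss discrepancy.) For every model and every $e^{\rm te}\in\mathcal E_{\rm te}$ satisfying Assumption 2 and having maximal norm $B$, every $\lambda>0$, and every probability distribution $P$ on $\mathcal H$ with $T_h^L\epsilon\le\gamma/8$ for $P$-almost every $h$, $$\ln\mathbb E_{h\sim P}\,e^{\lambda(\mathcal L^{\gamma/4}_{e^{\rm te}}(h)-\mathcal L^{\gamma/2}_{e^{\rm tr}}(h))}\le\lambda K\big(\mathrm{(a)}+\mathrm{(b)}+\mathrm{(c)}\big).$$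 2. (Subgroup OOD generalization bound.) For all $\alpha\in(0,\frac14)$, all $\delta\in(0,1)$ such that the logarithm in $\mathrm{const}$ is positive, and every $R$, there is $N_0$ such that for every model and every $e^{\rm te}\in\mathcal E_{\rm te}$ with $N\ge N_0$ and maximal norm $B$ that satisfy Assumptions 2 and 3, with probability at least $1-\delta$ over the training labels, every $h\in\mathcal H$ with $T_h\le R$ satisfies $$\mathcal L^0_{e^{\rm te}}(h)\le\widehat{\mathcal L}^\gamma_{e^{\rm tr}}(h)+K\big(\mathrm{(a)}+\mathrm{(b)}+\mathrm{(c)}+\mathrm{(d)}_h+\mathrm{const}\big).$$ -/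

import Mathlib

open MeasureTheory ProbabilityTheory

noncomputable section

namespace SubgroupOOD

/-! ### ReLU multilayer perceptrons -/

/-- Weight matrices of a multilayer perceptron without biases, with input coordinates `ι`,
hidden layers of the widths listed in `ks`, and `C` outputs. It has `ks.length + 1` layers. -/
def Params (C : ℕ) : Type → List ℕ → Type
  | ι, [] => Fin C → ι → ℝ
  | ι, k :: ks => (Fin k → ι → ℝ) × Params C (Fin k) ks

namespace Params

variable {C : ℕ}

/-- The Borel sigma-algebra of the (finite-dimensional) parameter space. -/
@[reducible]
def measurableSpace (C : ℕ) : (ι : Type) → (ks : List ℕ) → MeasurableSpace (Params C ι ks)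
  | ι, [] => inferInstanceAs (MeasurableSpace (Fin C → ι → ℝ))
  | ι, k :: ks =>
    @Prod.instMeasurableSpace (Fin k → ι → ℝ) (Params C (Fin k) ks) inferInstance
      (measurableSpace C (Fin k) ks)

instance (ι : Type) (ks : List ℕ) : MeasurableSpace (Params C ι ks) := measurableSpace C ι ks

/-- The network map: every layer but the last one is followed by the ReLU. -/
def apply : {ι : Type} → [Fintype ι] → (ks : List ℕ) → Params C ι ks → (ι → ℝ) → Fin C → ℝ
  | _, _, [], W, x => fun c => ∑ a, W c a * x a
  | _, _, _ :: ks, W, x => apply ks W.2 (fun u => max 0 (∑ a, W.1 u a * x a))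

/-- Spectral norm of a rectangular matrix. -/
def specNorm {m ι : Type} [Fintype m] [Fintype ι] [DecidableEq ι] (A : m → ι → ℝ) : ℝ :=
  ‖(Matrix.toEuclideanLin (Matrix.of A)).toContinuousLinearMap‖

/-- `T_h`, the largest spectral norm of a weight matrix. -/
def maxSpecNorm : {ι : Type} → [Fintype ι] → [DecidableEq ι] → (ks : List ℕ) →
    Params C ι ks → ℝ
  | _, _, _, [], W => specNorm (m := Fin C) W
  | _, _, _, _ :: ks, W => max (specNorm W.1) (maxSpecNorm ks W.2)

/-- The sum of the squared Frobenius norms of the weight matrices. -/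
def sumFrobSq : {ι : Type} → [Fintype ι] → (ks : List ℕ) → Params C ι ks → ℝ
  | _, _, [], W => ∑ c : Fin C, ∑ a, (W c a) ^ 2
  | _, _, _ :: ks, W => (∑ u, ∑ a, (W.1 u a) ^ 2) + sumFrobSq ks W.2

/-- All the weights drawn independently from the centred normal distribution of variance `v`. -/
def gaussian (v : NNReal) : {ι : Type} → [Fintype ι] → (ks : List ℕ) → Measure (Params C ι ks)
  | ι, _, [] => (Measure.pi fun _ : Fin C => Measure.pi fun _ : ι => gaussianReal 0 v)
  | ι, _, k :: ks =>
    Measure.prod (α := Fin k → ι → ℝ) (β := Params C (Fin k) ks)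
      (Measure.pi fun _ : Fin k => Measure.pi fun _ : ι => gaussianReal 0 v)
      (gaussian v (ι := Fin k) ks)

end Params

/-- The number of layers. -/
def depth (ks : List ℕ) : ℕ := ks.length + 1

/-- The largest width of a hidden layer. -/
def maxWidth (ks : List ℕ) : ℕ := ks.foldr max 0

/-! ### The contextual stochastic block model -/

/-- Node features: an invariant block followed by a spurious block of the same dimension. -/
abbrev Feat (d : ℕ) : Type := EuclideanSpace ℝ (Fin d ⊕ Fin d)

/-- The concatenation `[u; v]`. -/
def concat {d : ℕ} (u v : EuclideanSpace ℝ (Fin d)) : Feat d :=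
  WithLp.toLp 2 (Sum.elim (fun k => u k) (fun k => v k))

/-- An environment: a finite graph with node features (as observed), the spurious means of the
classes, and for each node the ratios of the classes among its neighbours.
`pHm i` is the homophilic ratio, and `pHt i c c'` is the ratio of neighbours of class `c'` when
node `i` has class `c`; the value for `c' = c` is never used. -/
structure Environment (d C : ℕ) where
  V : Type
  [fintypeV : Fintype V]
  [nonemptyV : Nonempty V]
  graph : SimpleGraph V
  exists_adj : ∀ i, ∃ j, graph.Adj i j
  feature : V → Feat d
  muSp : Fin C → EuclideanSpace ℝ (Fin d)
  orthonormal_muSp : Orthonormal ℝ muSp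
  pHm : V → ℝ
  pHt : V → Fin C → Fin C → ℝ
  pHm_nonneg : ∀ i, 0 ≤ pHm i
  pHt_nonneg : ∀ i c c', c' ≠ c → 0 ≤ pHt i c c'
  sum_ratio : ∀ i c, pHm i + ∑ c' ∈ Finset.univ.filter (fun c' => c' ≠ c), pHt i c c' = 1

attribute [instance] Environment.fintypeV Environment.nonemptyV

/-- The model: invariant class means, shared by all the environments, a training environment, and
a family of test environments; `σ` is the standard deviation of the features of a class. -/
structure CSBM (d C : ℕ) (σ : ℝ) where
  mu : Fin C → EuclideanSpace ℝ (Fin d)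
  orthonormal_mu : Orthonormal ℝ mu
  train : Environment d C
  Test : Type
  test : Test → Environment d C

namespace Environment

variable {d C : ℕ}

/-- The number of nodes. -/
def size (E : Environment d C) : ℕ := Fintype.card E.V

open Classical in
/-- The one-hop neighbours of a node. -/
def neighbors (E : Environment d C) (i : E.V) : Finset E.V :=
  Finset.univ.filter fun j => E.graph.Adj i j

/-- The aggregated feature `g_i`: the mean of the features of the neighbours. -/
def agg (E : Environment d C) (i : E.V) : Feat d :=
  ((E.neighbors i).card : ℝ)⁻¹ • ∑ j ∈ E.neighbors i, E.feature j

end Environment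

namespace CSBM

variable {d C : ℕ} {σ : ℝ}

/-- The mean `[μ_c; μ_c^e]` of the features of the nodes of class `c` in an environment. -/
def featMean (M : CSBM d C σ) (E : Environment d C) (c : Fin C) : Feat d :=
  concat (M.mu c) (E.muSp c)

/-- The mean of the aggregated feature of node `i` when its class is `c`. -/
def aggMean (M : CSBM d C σ) (E : Environment d C) (i : E.V) (c : Fin C) : Feat d :=
  E.pHm i • M.featMean E c +
    ∑ c' ∈ Finset.univ.filter (fun c' => c' ≠ c), E.pHt i c c' • M.featMean E c'

/-- `Pr(g_i = z | y_i = c)`: the density of the normal distribution on `ℝ^(2d)` with mean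
`aggMean` and covariance `σ ^ 2` times the identity. -/
def density (M : CSBM d C σ) (E : Environment d C) (i : E.V) (c : Fin C) (z : Feat d) : ℝ :=
  (Real.sqrt ((2 * Real.pi * σ ^ 2) ^ (2 * d)))⁻¹ *
    Real.exp (-(‖z - M.aggMean E i c‖ ^ 2 / (2 * σ ^ 2)))

/-- `Pr(y_i = c | g_i)`, by the rule of Bayes; the classes have the same prior probability. -/
def posterior (M : CSBM d C σ) (E : Environment d C) (i : E.V) (c : Fin C) : ℝ :=
  ((C : ℝ)⁻¹ * M.density E i c (E.agg i)) / ∑ c', (C : ℝ)⁻¹ * M.density E i c' (E.agg i)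

/-- The law of the label of node `i` given the aggregated feature. -/
def nodeLabelLaw (M : CSBM d C σ) (E : Environment d C) (i : E.V) : Measure (Fin C) :=
  ∑ c, ENNReal.ofReal (M.posterior E i c) • Measure.dirac c

/-- The law of all the labels of an environment given the aggregated features: the labels are
independent. -/
def labelLaw (M : CSBM d C σ) (E : Environment d C) : Measure (E.V → Fin C) :=
  Measure.pi fun i => M.nodeLabelLaw E i

end CSBM

/-! ### Margin losses -/

open Classical in
/-- `1[z_y ≤ γ + max_{c ≠ y} z_c]`. -/
def marginLoss {C : ℕ} (γ : ℝ) (z : Fin C → ℝ) (y : Fin C) : ℝ :=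
  if z y ≤ γ + ⨆ c : {c : Fin C // c ≠ y}, z c then 1 else 0

/-- The logits of node `i`: the perceptron applied to the aggregated feature. -/
def logits {d C : ℕ} (E : Environment d C) (ks : List ℕ) (W : Params C (Fin d ⊕ Fin d) ks)
    (i : E.V) : Fin C → ℝ :=
  Params.apply ks W (fun k => E.agg i k)

/-- The empirical margin loss for the labels `y`. -/
def empLoss {d C : ℕ} (E : Environment d C) (ks : List ℕ) (γ : ℝ)
    (W : Params C (Fin d ⊕ Fin d) ks) (y : E.V → Fin C) : ℝ :=
  (1 / (E.size : ℝ)) * ∑ i, marginLoss γ (logits E ks W i) (y i)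

namespace CSBM

variable {d C : ℕ} {σ : ℝ}

/-- The expected margin loss. -/
def expLoss (M : CSBM d C σ) (E : Environment d C) (ks : List ℕ) (γ : ℝ)
    (W : Params C (Fin d ⊕ Fin d) ks) : ℝ :=
  ∫ y, empLoss E ks γ W y ∂(M.labelLaw E)

/-! ### Comparison of the training environment with a test environment -/

/-- The aggregated-feature distance `max_{j test} min_{i train} ‖g_i - g_j‖`. -/
def dist (M : CSBM d C σ) (e : M.Test) : ℝ :=
  ⨆ j : (M.test e).V, ⨅ i : M.train.V, ‖M.train.agg i - (M.test e).agg j‖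

/-- The largest norm of an aggregated feature of a training or test node. -/
def maxNorm (M : CSBM d C σ) (e : M.Test) : ℝ :=
  max (⨆ i : M.train.V, ‖M.train.agg i‖) (⨆ j : (M.test e).V, ‖(M.test e).agg j‖)

open Classical in
/-- The test nodes near the training node `i`. -/
def near (M : CSBM d C σ) (e : M.Test) (i : M.train.V) : Finset (M.test e).V :=
  Finset.univ.filter fun j => ‖M.train.agg i - (M.test e).agg j‖ ≤ M.dist e

/-- Equal-sized and disjoint near sets; `s` is the common size. -/
def NearSets (M : CSBM d C σ) (e : M.Test) (s : ℕ) : Prop :=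
  0 < s ∧ (∀ i, (M.near e i).card = s) ∧
    ∀ i i', i ≠ i' → Disjoint (M.near e i) (M.near e i')

/-- The upper bound `(γ / (8 ε))^(2/L) / (2 b (λ N^(-α) + ln (2 b L)))` for the prior variance, with
`λ = N^(2α)`, where `N` is the number of training nodes. -/
def priorVarBound (M : CSBM d C σ) (e : M.Test) (ks : List ℕ) (γ α : ℝ) : ℝ :=
  (γ / (8 * M.dist e)) ^ (2 / (depth ks : ℝ)) /
    (2 * maxWidth ks * ((M.train.size : ℝ) ^ (2 * α) * (M.train.size : ℝ) ^ (-α) +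
      Real.log (2 * maxWidth ks * depth ks)))

/-- Concentrated expected loss difference: for a Gaussian prior `P` whose variance is at most
`priorVarBound`, and at least the fraction `κ` of it, conditionally on `T_h ^ L * ε > γ / 8`, the
loss difference exceeds `N^(-α) + H C ε` with probability at most `exp (-N^(2α))`. -/
def Concentrated (M : CSBM d C σ) (e : M.Test) (ks : List ℕ) (γ α H κ : ℝ) : Prop :=
  ∃ v : ℝ, κ * M.priorVarBound e ks γ α ≤ v ∧ v ≤ M.priorVarBound e ks γ α ∧
    (ProbabilityTheory.cond (Params.gaussian (C := C) v.toNNReal (ι := Fin d ⊕ Fin d) ks)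
      {W | γ / 8 < Params.maxSpecNorm ks W ^ depth ks * M.dist e}).real
      {W | (M.train.size : ℝ) ^ (-α) + H * C * M.dist e <
        M.expLoss (M.test e) ks (γ / 4) W - M.expLoss M.train ks (γ / 2) W} ≤
    Real.exp (-(M.train.size : ℝ) ^ (2 * α))

/-- The expected loss discrepancy `ln E_{h ∼ P} exp (λ (L_te^(γ/2)(h) - L_tr^γ(h)))`. -/
def discrepancy (M : CSBM d C σ) (e : M.Test) (ks : List ℕ) (γ lam : ℝ)
    (P : Measure (Params C (Fin d ⊕ Fin d) ks)) : ℝ :=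
  Real.log (∫ W, Real.exp
    (lam * (M.expLoss (M.test e) ks (γ / 2) W - M.expLoss M.train ks γ W)) ∂P)

/-! ### The terms of the bound -/

/-- Class separability times aggregated-feature distance. -/
def termA (M : CSBM d C σ) (e : M.Test) : ℝ :=
  1 / σ ^ 2 * ((∑ c : Fin C, ∑ c' ∈ Finset.univ.filter (fun c' => c' ≠ c),
    (Real.sqrt ‖concat (M.mu c - M.mu c') ((M.test e).muSp c - (M.test e).muSp c')‖ +
      2 * Real.sqrt 2)) * M.dist e)

/-- Shift of the spurious means. -/
def termB (M : CSBM d C σ) (e : M.Test) : ℝ :=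
  1 / σ ^ 2 * (2 * ∑ c : Fin C,
    ((C : ℝ) - 1) * M.maxNorm e * ‖(M.test e).muSp c - M.train.muSp c‖)

/-- Shift of the label distributions of the heterophilic neighbours. -/
def termC (M : CSBM d C σ) (e : M.Test) (s : ℕ) : ℝ :=
  1 / (2 * σ ^ 2) * ((1 / (M.train.size : ℝ)) * ∑ i : M.train.V,
    (1 / (s : ℝ)) * ∑ j ∈ M.near e i,
      ∑ c : Fin C, ∑ c' ∈ Finset.univ.filter (fun c' => c' ≠ c),
        |(M.test e).pHt j c c' - M.train.pHt i c c'|)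

/-- The weight-norm term. -/
def termD (M : CSBM d C σ) (e : M.Test) (ks : List ℕ) (γ α : ℝ)
    (W : Params C (Fin d ⊕ Fin d) ks) : ℝ :=
  (maxWidth ks * Params.sumFrobSq ks W) /
      ((γ / 8) ^ (2 / (depth ks : ℝ)) * (M.train.size : ℝ) ^ α) *
    M.dist e ^ (2 / (depth ks : ℝ))

/-- The argument `L C (2B)^(1/L) / (γ^(1/L) δ)` of the logarithm in the constant term. -/
def logArg (C : ℕ) (ks : List ℕ) (B γ δ : ℝ) : ℝ :=
  (depth ks : ℝ) * C * (2 * B) ^ (1 / (depth ks : ℝ)) / (γ ^ (1 / (depth ks : ℝ)) * δ)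

/-- The constant term. -/
def termConst (M : CSBM d C σ) (e : M.Test) (ks : List ℕ) (γ α δ : ℝ) : ℝ :=
  1 / (M.train.size : ℝ) ^ (1 - 2 * α) +
    1 / (M.train.size : ℝ) ^ (2 * α) * Real.log (logArg C ks (M.maxNorm e) γ δ)

end CSBM

end SubgroupOOD

end

/-!
On the event `T ^ L * ε ≤ γ / 8` the logits of a test node and of the training node near it differ
by at most `γ / 8`, and the label laws of the two nodes differ by at most the gap of their log
densities. Averaging over the near sets bounds the difference of the expected losses, hence its
exponential moments, by a multiple of (a) + (b) + (c).

For the generalization bound, perceptrons with `T ^ L * ε > γ / 8` have to be treated one by one,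
while the concentration assumption only speaks of most of them. But for variances in the assumed
range a Gaussian prior gives a ball of fixed radius mass at least `(a * exp (-b * N ^ α)) ^ n`,
where `n` is the number of weights, and this exceeds `exp (-N ^ (2 * α))` for large `N`. So near
every such perceptron there is one whose loss difference is at most `N ^ (-α) + H * C * ε`, and the
margin absorbs the change of the logits. Here `N ^ (-α)` is at most the term (d) and `ε` is at most
`σ ^ 2` times the term (a). The passage from expected to empirical training loss is Chebyshev's
inequality, made uniform by a finite net.
-/

noncomputable section

namespace SubgroupOOD

namespace Params

variable {C : ℕ}

/-! ### The spectral norm -/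

section SpecNorm

open scoped Matrix Matrix.Norms.L2Operator

variable {m ι : Type} [Fintype m] [Fintype ι] [DecidableEq ι]

theorem specNorm_nonneg (A : m → ι → ℝ) : 0 ≤ specNorm A := norm_nonneg (Matrix.of A)

theorem specNorm_smul (t : ℝ) (A : m → ι → ℝ) : specNorm (t • A) = |t| * specNorm A :=
  norm_smul t (Matrix.of A)

theorem continuous_specNorm : Continuous (specNorm : (m → ι → ℝ) → ℝ) :=
  let toCLM : (m → ι → ℝ) →ₗ[ℝ] EuclideanSpace ℝ ι →L[ℝ] EuclideanSpace ℝ m :=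
    LinearMap.toContinuousLinearMap.toLinearMap ∘ₗ Matrix.toEuclideanLin.toLinearMap ∘ₗ
      (Matrix.ofLinearEquiv ℝ).toLinearMap
  toCLM.continuous_of_finiteDimensional.norm

theorem norm_mulVec_le_specNorm_mul (A : m → ι → ℝ) (x : ι → ℝ) :
    ‖WithLp.toLp 2 (Matrix.of A *ᵥ x)‖ ≤ specNorm A * ‖WithLp.toLp 2 x‖ :=
  Matrix.l2_opNorm_mulVec (Matrix.of A) (WithLp.toLp 2 x)

theorem norm_le_specNorm (A : m → ι → ℝ) : ‖A‖ ≤ specNorm A := by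
  refine (pi_norm_le_iff_of_nonneg (specNorm_nonneg A)).2 fun u =>
    (pi_norm_le_iff_of_nonneg (specNorm_nonneg A)).2 fun a => ?_
  calc ‖A u a‖ = ‖WithLp.toLp 2 (Matrix.of A *ᵥ Pi.single a 1) u‖ := by simp
    _ ≤ ‖WithLp.toLp 2 (Matrix.of A *ᵥ Pi.single a 1)‖ := PiLp.norm_apply_le _ u
    _ ≤ specNorm A * ‖WithLp.toLp 2 (Pi.single a (1 : ℝ) : ι → ℝ)‖ :=
        norm_mulVec_le_specNorm_mul A _
    _ = specNorm A := by simp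

theorem specNorm_sq_le_sum_sq (A : m → ι → ℝ) : specNorm A ^ 2 ≤ ∑ u, ∑ a, A u a ^ 2 := by
  refine (Real.le_sqrt (specNorm_nonneg A) (by positivity)).1
    (ContinuousLinearMap.opNorm_le_bound _ (Real.sqrt_nonneg _) fun x => ?_)
  rw [EuclideanSpace.norm_eq, EuclideanSpace.norm_eq, ← Real.sqrt_mul (by positivity),
    Finset.sum_mul]
  refine Real.sqrt_le_sqrt (Finset.sum_le_sum fun u _ => ?_)
  simpa [Matrix.toEuclideanLin, Matrix.mulVec, dotProduct] using
    Finset.sum_mul_sq_le_sq_mul_sq Finset.univ (A u) x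

end SpecNorm

/-! ### The parameter space as a normed space -/

/-- The sup norm of all the weights. -/
@[reducible]
def normedAddCommGroup (C : ℕ) :
    (ι : Type) → [Fintype ι] → (ks : List ℕ) → NormedAddCommGroup (Params C ι ks)
  | ι, _, [] => inferInstanceAs (NormedAddCommGroup (Fin C → ι → ℝ))
  | ι, _, k :: ks =>
    @Prod.normedAddCommGroup (Fin k → ι → ℝ) (Params C (Fin k) ks) inferInstance
      (normedAddCommGroup C (Fin k) ks)

instance (ι : Type) [Fintype ι] (ks : List ℕ) : NormedAddCommGroup (Params C ι ks) :=
  normedAddCommGroup C ι ks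

/-- The entrywise action of the scalars. -/
@[reducible]
def normedSpace (C : ℕ) :
    (ι : Type) → [Fintype ι] → (ks : List ℕ) → NormedSpace ℝ (Params C ι ks)
  | ι, _, [] => inferInstanceAs (NormedSpace ℝ (Fin C → ι → ℝ))
  | ι, _, k :: ks =>
    @Prod.normedSpace ℝ (Fin k → ι → ℝ) (Params C (Fin k) ks) _ inferInstance
      (normedAddCommGroup C (Fin k) ks).toSeminormedAddCommGroup inferInstance
      (normedSpace C (Fin k) ks)

instance (ι : Type) [Fintype ι] (ks : List ℕ) : NormedSpace ℝ (Params C ι ks) :=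
  normedSpace C ι ks

instance properSpace : (ι : Type) → [Fintype ι] → (ks : List ℕ) → ProperSpace (Params C ι ks)
  | ι, _, [] => inferInstanceAs (ProperSpace (Fin C → ι → ℝ))
  | ι, _, k :: ks =>
    have := properSpace (Fin k) ks
    inferInstanceAs (ProperSpace ((Fin k → ι → ℝ) × Params C (Fin k) ks))

instance borelSpace : (ι : Type) → [Fintype ι] → (ks : List ℕ) → BorelSpace (Params C ι ks)
  | ι, _, [] => inferInstanceAs (BorelSpace (Fin C → ι → ℝ))
  | ι, _, k :: ks =>
    have := borelSpace (Fin k) ks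
    inferInstanceAs (BorelSpace ((Fin k → ι → ℝ) × Params C (Fin k) ks))

/-! ### The largest spectral norm and the Frobenius norms -/

theorem maxSpecNorm_nonneg {ι : Type} [Fintype ι] [DecidableEq ι] (ks : List ℕ)
    (W : Params C ι ks) :
    0 ≤ maxSpecNorm ks W :=
  match ks with
  | [] => specNorm_nonneg (m := Fin C) W
  | _ :: _ => le_max_of_le_left (specNorm_nonneg W.1)

theorem norm_le_maxSpecNorm : ∀ {ι : Type} [Fintype ι] [DecidableEq ι] (ks : List ℕ)
    (W : Params C ι ks), ‖W‖ ≤ maxSpecNorm ks W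
  | _, _, _, [], W => norm_le_specNorm (m := Fin C) W
  | _, _, _, _ :: ks, W => max_le_max (norm_le_specNorm W.1) (norm_le_maxSpecNorm ks W.2)

theorem maxSpecNorm_smul {t : ℝ} (ht : 0 ≤ t) : ∀ {ι : Type} [Fintype ι] [DecidableEq ι]
    (ks : List ℕ) (W : Params C ι ks), maxSpecNorm ks (t • W) = t * maxSpecNorm ks W
  | _, _, _, [], W => (specNorm_smul (m := Fin C) t W).trans (by rw [abs_of_nonneg ht]; rfl)
  | _, _, _, _ :: ks, W =>
    (congrArg₂ max (specNorm_smul t W.1) (maxSpecNorm_smul ht ks W.2)).trans (by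
      rw [abs_of_nonneg ht, ← mul_max_of_nonneg _ _ ht]; rfl)

theorem continuous_maxSpecNorm : ∀ {ι : Type} [Fintype ι] [DecidableEq ι] (ks : List ℕ),
    Continuous (maxSpecNorm ks : Params C ι ks → ℝ)
  | _, _, _, [] => continuous_specNorm (m := Fin C)
  | _, _, _, _ :: ks =>
    (continuous_specNorm.comp continuous_fst).max ((continuous_maxSpecNorm ks).comp continuous_snd)

theorem sumFrobSq_nonneg : ∀ {ι : Type} [Fintype ι] (ks : List ℕ) (W : Params C ι ks),
    0 ≤ sumFrobSq ks W
  | _, _, [], _ => Finset.sum_nonneg fun _ _ => Finset.sum_nonneg fun _ _ => sq_nonneg _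
  | _, _, _ :: ks, W => add_nonneg
      (Finset.sum_nonneg fun _ _ => Finset.sum_nonneg fun _ _ => sq_nonneg _)
      (sumFrobSq_nonneg ks W.2)

theorem maxSpecNorm_sq_le_sumFrobSq : ∀ {ι : Type} [Fintype ι] [DecidableEq ι] (ks : List ℕ)
    (W : Params C ι ks), maxSpecNorm ks W ^ 2 ≤ sumFrobSq ks W
  | _, _, _, [], W => specNorm_sq_le_sum_sq (m := Fin C) W
  | _, _, _, _ :: ks, W => by
      have hfst := specNorm_sq_le_sum_sq W.1
      have hsnd := maxSpecNorm_sq_le_sumFrobSq ks W.2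
      rw [maxSpecNorm, sumFrobSq]
      rcases max_choice (specNorm W.1) (maxSpecNorm ks W.2) with h | h <;> rw [h]
      · exact hfst.trans (le_add_of_nonneg_right (sumFrobSq_nonneg ks W.2))
      · exact hsnd.trans (le_add_of_nonneg_left (by positivity))

/-! ### Continuity of the network map -/

section NetworkMap

open scoped Matrix

theorem norm_relu_sub_relu_le {ι : Type} [Fintype ι] (x y : ι → ℝ) :
    ‖WithLp.toLp 2 (fun a => max 0 (x a)) - WithLp.toLp 2 (fun a => max 0 (y a))‖ ≤
      ‖WithLp.toLp 2 x - WithLp.toLp 2 y‖ := by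
  rw [EuclideanSpace.norm_eq, EuclideanSpace.norm_eq]
  refine Real.sqrt_le_sqrt (Finset.sum_le_sum fun a _ => pow_le_pow_left₀ (norm_nonneg _) ?_ 2)
  simpa only [max_comm, PiLp.sub_apply, Real.norm_eq_abs] using abs_max_sub_max_le_abs (x a) (y a) 0

theorem norm_mulVec_sub_mulVec_le {m ι : Type} [Fintype m] [Fintype ι] [DecidableEq ι]
    (A : m → ι → ℝ) (x y : ι → ℝ) :
    ‖WithLp.toLp 2 (Matrix.of A *ᵥ x) - WithLp.toLp 2 (Matrix.of A *ᵥ y)‖ ≤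
      specNorm A * ‖WithLp.toLp 2 x - WithLp.toLp 2 y‖ := by
  rw [← WithLp.toLp_sub, ← WithLp.toLp_sub, ← Matrix.mulVec_sub]
  exact norm_mulVec_le_specNorm_mul A (x - y)

theorem norm_apply_sub_apply_le : ∀ {ι : Type} [Fintype ι] [DecidableEq ι] (ks : List ℕ)
    (W : Params C ι ks) (x y : ι → ℝ),
    ‖WithLp.toLp 2 (apply ks W x) - WithLp.toLp 2 (apply ks W y)‖ ≤
      maxSpecNorm ks W ^ depth ks * ‖WithLp.toLp 2 x - WithLp.toLp 2 y‖
  | _, _, _, [], W, x, y =>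
    (norm_mulVec_sub_mulVec_le (m := Fin C) W x y).trans_eq (by
      rw [depth, List.length_nil, zero_add, pow_one]; rfl)
  | _, _, _, k :: ks, W, x, y => by
      have hT := maxSpecNorm_nonneg ks W.2
      calc _ ≤ maxSpecNorm ks W.2 ^ depth ks *
              (specNorm W.1 * ‖WithLp.toLp 2 x - WithLp.toLp 2 y‖) :=
            (norm_apply_sub_apply_le ks W.2 _ _).trans (mul_le_mul_of_nonneg_left
              ((norm_relu_sub_relu_le _ _).trans (norm_mulVec_sub_mulVec_le W.1 x y))
              (pow_nonneg hT _))
        _ ≤ max (specNorm W.1) (maxSpecNorm ks W.2) ^ depth ks *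
              (max (specNorm W.1) (maxSpecNorm ks W.2) * ‖WithLp.toLp 2 x - WithLp.toLp 2 y‖) := by
            have hnorm := specNorm_nonneg W.1
            gcongr
            · exact le_max_right (specNorm W.1) _
            · exact le_max_left (specNorm W.1) _
        _ = _ := by rw [← mul_assoc, ← pow_succ]; rfl

theorem continuous_apply : ∀ {ι : Type} [Fintype ι] (ks : List ℕ),
    Continuous fun p : Params C ι ks × (ι → ℝ) => apply ks p.1 p.2
  | ι, _, [] =>
    show Continuous fun p : (Fin C → ι → ℝ) × (ι → ℝ) => fun c => ∑ a, p.1 c a * p.2 a by fun_prop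
  | ι, _, k :: ks => by
      have hlayer : Continuous fun p : (Fin k → ι → ℝ) × (ι → ℝ) =>
          fun u => max 0 (∑ a, p.1 u a * p.2 a) := by fun_prop
      exact (continuous_apply ks).comp ((continuous_snd.comp continuous_fst).prodMk
        (hlayer.comp ((continuous_fst.comp continuous_fst).prodMk continuous_snd)))

theorem exists_abs_apply_sub_apply_le {ι : Type} [Fintype ι] (ks : List ℕ) (R B : ℝ) {η : ℝ}
    (hη : 0 < η) : ∃ ρ > 0, ∀ W W' : Params C ι ks, ‖W‖ ≤ R → ‖W'‖ ≤ R → dist W W' ≤ ρ →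
      ∀ x : ι → ℝ, ‖x‖ ≤ B → ∀ c, |apply ks W x c - apply ks W' x c| ≤ η := by
  have huc := ((isCompact_closedBall (0 : Params C ι ks) R).prod
    (isCompact_closedBall (0 : ι → ℝ) B)).uniformContinuousOn_of_continuous
      (continuous_apply ks).continuousOn
  obtain ⟨ρ, hρ, h⟩ := Metric.uniformContinuousOn_iff_le.1 huc η hη
  refine ⟨ρ, hρ, fun W W' hW hW' hWW x hx c => ?_⟩
  have hmem : ∀ V : Params C ι ks, ‖V‖ ≤ R →
      (V, x) ∈ Metric.closedBall (0 : Params C ι ks) R ×ˢ Metric.closedBall (0 : ι → ℝ) B :=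
    fun V hV => ⟨mem_closedBall_zero_iff.2 hV, mem_closedBall_zero_iff.2 hx⟩
  rw [← Real.dist_eq]
  refine (dist_le_pi_dist _ _ c).trans (h _ (hmem W hW) _ (hmem W' hW') ?_)
  rwa [Prod.dist_eq, dist_self, max_eq_left dist_nonneg]

end NetworkMap

/-! ### Gaussian measures of balls -/

section Gaussian

theorem pow_card_le_pi_closedBall {X ι : Type*} [Fintype ι] [PseudoMetricSpace X]
    [MeasurableSpace X] {μ : Measure X} [SigmaFinite μ] {p : ENNReal} {r : ℝ} (hr : 0 ≤ r)
    {x : ι → X} (h : ∀ i, p ≤ μ (Metric.closedBall (x i) r)) :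
    p ^ Fintype.card ι ≤ Measure.pi (fun _ => μ) (Metric.closedBall x r) := by
  rw [closedBall_pi x hr, Measure.pi_pi]
  exact Finset.pow_card_le_prod Finset.univ _ p fun i _ => h i

instance isProbabilityMeasure_gaussian (v : NNReal) : ∀ {ι : Type} [Fintype ι] (ks : List ℕ),
    IsProbabilityMeasure (gaussian (C := C) v (ι := ι) ks)
  | ι, _, [] => inferInstanceAs (IsProbabilityMeasure
      (Measure.pi fun _ : Fin C => Measure.pi fun _ : ι => gaussianReal 0 v))
  | ι, _, k :: ks =>
    have := isProbabilityMeasure_gaussian v (ι := Fin k) ks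
    inferInstanceAs (IsProbabilityMeasure (Measure.prod
      (Measure.pi fun _ : Fin k => Measure.pi fun _ : ι => gaussianReal 0 v)
      (gaussian (C := C) v (ι := Fin k) ks)))

/-- The number of weights of the network. -/
def numWeights (C : ℕ) : (ι : Type) → [Fintype ι] → List ℕ → ℕ
  | ι, _, [] => Fintype.card ι * C
  | ι, _, k :: ks => Fintype.card ι * k + numWeights C (Fin k) ks

theorem pow_le_gaussianMatrix_closedBall {v : NNReal} {p : ENNReal} {r R : ℝ} (hr : 0 ≤ r)
    (h : ∀ x : ℝ, |x| ≤ R → p ≤ gaussianReal 0 v (Metric.closedBall x r))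
    {k : ℕ} {ι : Type} [Fintype ι] (A : Fin k → ι → ℝ) (hA : ‖A‖ ≤ R) :
    p ^ (Fintype.card ι * k) ≤
      (Measure.pi fun _ : Fin k => Measure.pi fun _ : ι => gaussianReal 0 v)
        (Metric.closedBall A r) := by
  have hrow : ∀ u, p ^ Fintype.card ι ≤
      (Measure.pi fun _ : ι => gaussianReal 0 v) (Metric.closedBall (A u) r) := fun u =>
    pow_card_le_pi_closedBall hr fun a =>
      h _ (((norm_le_pi_norm (A u) a).trans (norm_le_pi_norm A u)).trans hA)
  simpa only [pow_mul, Fintype.card_fin] using pow_card_le_pi_closedBall hr hrow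

theorem pow_numWeights_le_gaussian_closedBall {v : NNReal} {p : ENNReal} {r R : ℝ} (hr : 0 ≤ r)
    (h : ∀ x : ℝ, |x| ≤ R → p ≤ gaussianReal 0 v (Metric.closedBall x r)) :
    ∀ {ι : Type} [Fintype ι] (ks : List ℕ) (W : Params C ι ks), ‖W‖ ≤ R →
      p ^ numWeights C ι ks ≤ gaussian v ks (Metric.closedBall W r)
  | _, _, [], W, hW => pow_le_gaussianMatrix_closedBall (k := C) hr h W hW
  | ι, _, k :: ks, W, hW => by
      have hball : gaussian v (k :: ks) (Metric.closedBall W r) =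
          (Measure.pi fun _ : Fin k => Measure.pi fun _ : ι => gaussianReal 0 v)
            (Metric.closedBall W.1 r) * gaussian v ks (Metric.closedBall W.2 r) :=
        (congrArg _ (closedBall_prod_same W.1 W.2 r).symm).trans (Measure.prod_prod _ _)
      rw [hball, numWeights, pow_add]
      exact mul_le_mul' (pow_le_gaussianMatrix_closedBall hr h W.1 ((le_max_left _ _).trans hW))
        (pow_numWeights_le_gaussian_closedBall hr h ks W.2 ((le_max_right _ _).trans hW))

theorem le_gaussianReal_closedBall {v : NNReal} (hv : v ≠ 0) {x r R : ℝ} (hx : |x| ≤ R) :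
    ENNReal.ofReal (2 * r * ((Real.sqrt (2 * Real.pi * v))⁻¹ *
      Real.exp (-(R + r) ^ 2 / (2 * v)))) ≤ gaussianReal 0 v (Metric.closedBall x r) := by
  rw [gaussianReal_apply _ hv, mul_comm (2 * r), ENNReal.ofReal_mul (by positivity),
    ← Real.volume_closedBall, ← setLIntegral_const]
  refine setLIntegral_mono (measurable_gaussianPDF _ _) fun y hy => ENNReal.ofReal_le_ofReal ?_
  have hyr : |y - 0| ≤ R + r := by
    have := abs_sub_abs_le_abs_sub y x
    rw [Metric.mem_closedBall, Real.dist_eq] at hy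
    rw [sub_zero]
    linarith
  have hsq : (y - 0) ^ 2 ≤ (R + r) ^ 2 := sq_le_sq' (abs_le.1 hyr).1 (abs_le.1 hyr).2
  unfold gaussianPDFReal
  gcongr

end Gaussian

end Params

/-! ### Margin losses -/

theorem ciSup_le_ciSup_add {ι : Type*} [Finite ι] {f g : ι → ℝ} {η : ℝ} (hη : 0 ≤ η)
    (h : ∀ i, f i ≤ g i + η) : ⨆ i, f i ≤ (⨆ i, g i) + η := by
  cases isEmpty_or_nonempty ι
  · simpa only [Real.iSup_of_isEmpty, zero_add] using hη
  · exact ciSup_le fun i => (h i).trans (add_le_add_left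
      (le_ciSup (Set.finite_range g).bddAbove i) η)

section MarginLoss

variable {C : ℕ}

theorem marginLoss_nonneg (γ : ℝ) (z : Fin C → ℝ) (y : Fin C) : 0 ≤ marginLoss γ z y := by
  unfold marginLoss; split_ifs <;> norm_num

theorem marginLoss_le_one (γ : ℝ) (z : Fin C → ℝ) (y : Fin C) : marginLoss γ z y ≤ 1 := by
  unfold marginLoss; split_ifs <;> norm_num

theorem marginLoss_le_marginLoss {γ γ' η : ℝ} {z z' : Fin C → ℝ}
    (h : ∀ c, |z c - z' c| ≤ η) (hγ : γ + 2 * η ≤ γ') (y : Fin C) :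
    marginLoss γ z y ≤ marginLoss γ' z' y := by
  by_cases hy : z y ≤ γ + ⨆ c : {c : Fin C // c ≠ y}, z c
  · have hsup : ⨆ c : {c : Fin C // c ≠ y}, z c ≤ (⨆ c : {c : Fin C // c ≠ y}, z' c) + η :=
      ciSup_le_ciSup_add ((abs_nonneg _).trans (h y)) fun c => by linarith [(abs_le.1 (h c)).2]
    have hy' : z' y ≤ γ' + ⨆ c : {c : Fin C // c ≠ y}, z' c := by
      linarith [(abs_le.1 (h y)).1]
    rw [marginLoss, marginLoss, if_pos hy, if_pos hy']
  · rw [marginLoss, if_neg hy]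
    exact marginLoss_nonneg γ' z' y

end MarginLoss

section Logits

variable {d C : ℕ} {ks : List ℕ}

theorem abs_logits_sub_logits_le (E E' : Environment d C) (W : Params C (Fin d ⊕ Fin d) ks)
    (i : E.V) (j : E'.V) (c : Fin C) :
    |logits E ks W i c - logits E' ks W j c| ≤
      Params.maxSpecNorm ks W ^ depth ks * ‖E.agg i - E'.agg j‖ :=
  (PiLp.norm_apply_le (WithLp.toLp 2 (logits E ks W i) - WithLp.toLp 2 (logits E' ks W j)) c).trans
    (Params.norm_apply_sub_apply_le ks W _ _)

theorem empLoss_le_empLoss {E : Environment d C} {γ γ' η : ℝ}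
    {W W' : Params C (Fin d ⊕ Fin d) ks}
    (h : ∀ i c, |logits E ks W i c - logits E ks W' i c| ≤ η) (hγ : γ + 2 * η ≤ γ')
    (y : E.V → Fin C) : empLoss E ks γ W y ≤ empLoss E ks γ' W' y := by
  unfold empLoss
  gcongr with i
  exact marginLoss_le_marginLoss (h i) hγ _

end Logits

namespace CSBM

variable {d C : ℕ} {σ : ℝ}

/-! ### The law of the labels -/

section LabelLaw

variable (M : CSBM d C σ) (E : Environment d C)

theorem density_pos (hσ : 0 < σ) (i : E.V) (c : Fin C) (z : Feat d) : 0 < M.density E i c z := by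
  unfold density
  positivity

theorem posterior_nonneg (i : E.V) (c : Fin C) : 0 ≤ M.posterior E i c := by
  unfold posterior density
  positivity

theorem posterior_eq_density_div_sum (i : E.V) (c : Fin C) :
    M.posterior E i c =
      M.density E i c (E.agg i) / ∑ c', M.density E i c' (E.agg i) := by
  have hC : (C : ℝ)⁻¹ ≠ 0 := inv_ne_zero (Nat.cast_ne_zero.2 c.pos.ne')
  rw [posterior, ← Finset.mul_sum, mul_div_mul_left _ _ hC]

theorem sum_posterior (hC : 0 < C) (hσ : 0 < σ) (i : E.V) : ∑ c, M.posterior E i c = 1 := by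
  simp only [posterior_eq_density_div_sum]
  rw [← Finset.sum_div]
  exact div_self (Finset.sum_pos (fun c _ => M.density_pos E hσ i c _)
    ⟨⟨0, hC⟩, Finset.mem_univ _⟩).ne'

instance isFiniteMeasure_nodeLabelLaw (i : E.V) : IsFiniteMeasure (M.nodeLabelLaw E i) := by
  constructor
  simp [nodeLabelLaw]

theorem isProbabilityMeasure_nodeLabelLaw (hC : 0 < C) (hσ : 0 < σ) (i : E.V) :
    IsProbabilityMeasure (M.nodeLabelLaw E i) := by
  constructor
  simp only [nodeLabelLaw, Measure.coe_finsetSum, Measure.coe_smul, Finset.sum_apply,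
    Pi.smul_apply, measure_univ, smul_eq_mul, mul_one]
  rw [← ENNReal.ofReal_sum_of_nonneg fun c _ => M.posterior_nonneg E i c,
    M.sum_posterior E hC hσ, ENNReal.ofReal_one]

theorem integral_nodeLabelLaw (i : E.V) (f : Fin C → ℝ) :
    ∫ c, f c ∂(M.nodeLabelLaw E i) = ∑ c, M.posterior E i c * f c := by
  rw [nodeLabelLaw, integral_finsetSum_measure fun c _ =>
    Integrable.of_finite.smul_measure ENNReal.ofReal_ne_top]
  refine Finset.sum_congr rfl fun c _ => ?_
  rw [integral_smul_measure, integral_dirac, ENNReal.toReal_ofReal (M.posterior_nonneg E i c),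
    smul_eq_mul]

variable {ks : List ℕ}

/-- The expected margin loss of a single node given its aggregated feature. -/
def nodeLoss (γ : ℝ) (W : Params C (Fin d ⊕ Fin d) ks) (i : E.V) : ℝ :=
  ∑ c, M.posterior E i c * marginLoss γ (logits E ks W i) c

theorem expLoss_eq_average_nodeLoss (hC : 0 < C) (hσ : 0 < σ) (γ : ℝ)
    (W : Params C (Fin d ⊕ Fin d) ks) :
    M.expLoss E ks γ W = (1 / (E.size : ℝ)) * ∑ i, M.nodeLoss E γ W i := by
  have := M.isProbabilityMeasure_nodeLabelLaw E hC hσ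
  unfold expLoss empLoss labelLaw
  rw [integral_const_mul, integral_finsetSum _ fun i _ => Integrable.of_finite]
  congr 1
  refine Finset.sum_congr rfl fun i _ => ?_
  rw [integral_comp_eval (μ := fun i => M.nodeLabelLaw E i)
    (f := fun c => marginLoss γ (logits E ks W i) c) (by fun_prop),
    integral_nodeLabelLaw, nodeLoss]

theorem expLoss_le_expLoss {γ γ' η : ℝ} {W W' : Params C (Fin d ⊕ Fin d) ks}
    (h : ∀ i c, |logits E ks W i c - logits E ks W' i c| ≤ η) (hγ : γ + 2 * η ≤ γ') :
    M.expLoss E ks γ W ≤ M.expLoss E ks γ' W' := by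
  unfold expLoss labelLaw
  exact integral_mono Integrable.of_finite Integrable.of_finite
    fun y => empLoss_le_empLoss h hγ y

end LabelLaw

end CSBM

/-! ### Comparison of posteriors -/

theorem div_sum_sub_div_sum_le {ι : Type*} [Fintype ι] {w w' : ι → ℝ} {t : ℝ}
    (hw : ∀ c, 0 < w c) (hw' : ∀ c, 0 < w' c) (h : ∀ c, w c ≤ Real.exp t * w' c)
    (h' : ∀ c, w' c ≤ Real.exp t * w c) (c : ι) :
    w c / ∑ b, w b - w' c / ∑ b, w' b ≤ 2 * t * (w c / ∑ b, w b) := by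
  have hS : 0 < ∑ b, w b := Finset.sum_pos (fun b _ => hw b) ⟨c, Finset.mem_univ _⟩
  have hS' : 0 < ∑ b, w' b := Finset.sum_pos (fun b _ => hw' b) ⟨c, Finset.mem_univ _⟩
  have hsum : ∑ b, w' b ≤ Real.exp t * ∑ b, w b := by
    rw [Finset.mul_sum]
    exact Finset.sum_le_sum fun b _ => h' b
  have hratio : Real.exp (-(2 * t)) * (w c / ∑ b, w b) ≤ w' c / ∑ b, w' b := by
    rw [le_div_iff₀ hS', mul_assoc]
    calc Real.exp (-(2 * t)) * ((w c / ∑ b, w b) * ∑ b, w' b)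
        ≤ Real.exp (-(2 * t)) * ((Real.exp t * w' c) / (∑ b, w b) * (Real.exp t * ∑ b, w b)) := by
          have := (hw c).le
          have := (hw' c).le
          gcongr
          exact h c
      _ = Real.exp (-(2 * t) + t + t) * w' c := by
          rw [Real.exp_add, Real.exp_add]
          field_simp
      _ = w' c := by rw [show -(2 * t) + t + t = 0 by ring, Real.exp_zero, one_mul]
  have hexp := mul_le_mul_of_nonneg_right (Real.add_one_le_exp (-(2 * t)))
    (div_nonneg (hw c).le hS.le)
  linarith

theorem norm_smul_sub_smul_le {V : Type*} [SeminormedAddCommGroup V] [NormedSpace ℝ V] {a b : ℝ}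
    (hb : 0 ≤ b) (u v : V) : ‖a • u - b • v‖ ≤ |a - b| * ‖u‖ + b * ‖u - v‖ := by
  calc ‖a • u - b • v‖ = ‖(a - b) • u + b • (u - v)‖ := congrArg _ (by module)
    _ ≤ ‖(a - b) • u‖ + ‖b • (u - v)‖ := norm_add_le _ _
    _ = |a - b| * ‖u‖ + b * ‖u - v‖ := by
      rw [norm_smul, norm_smul, Real.norm_of_nonneg hb, Real.norm_eq_abs]

theorem exp_neg_sq_norm_div_le {V : Type*} [SeminormedAddCommGroup V] {u v : V} {r q : ℝ}
    (hq : 0 < q) (hu : ‖u‖ ≤ r) (hv : ‖v‖ ≤ r) :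
    Real.exp (-(‖u‖ ^ 2 / (2 * q))) ≤
      Real.exp (r / q * ‖u - v‖) * Real.exp (-(‖v‖ ^ 2 / (2 * q))) := by
  have hsq : ‖v‖ ^ 2 - ‖u‖ ^ 2 ≤ ‖u - v‖ * (2 * r) := by
    rw [sq_sub_sq, mul_comm]
    refine (le_abs_self _).trans ?_
    rw [abs_mul, norm_sub_rev u v, abs_of_nonneg (by positivity : 0 ≤ ‖v‖ + ‖u‖)]
    exact mul_le_mul (abs_norm_sub_norm_le v u) (by linarith) (by positivity) (norm_nonneg _)
  have hdiv : (‖v‖ ^ 2 - ‖u‖ ^ 2) / (2 * q) ≤ r / q * ‖u - v‖ := by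
    rw [div_le_iff₀ (by positivity)]
    refine hsq.trans_eq ?_
    field_simp
  rw [← Real.exp_add]
  refine Real.exp_le_exp.2 ?_
  rw [sub_div] at hdiv
  linarith

namespace Environment

variable {d C : ℕ} (E E' : Environment d C)

/-- The total shift of the spurious class means between two environments. -/
def spuriousShift : ℝ := ∑ c, ‖E.muSp c - E'.muSp c‖

/-- The total shift of the heterophilic ratios between two nodes. -/
def ratioShift (i : E.V) (j : E'.V) : ℝ :=
  ∑ c, ∑ c' ∈ Finset.univ.filter (fun c' => c' ≠ c), |E.pHt i c c' - E'.pHt j c c'|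

/-- A bound of the difference of the log-densities, for each class, of two aggregated features of
norm at most `B` and distance at most `ε`. -/
def logDensityGap (σ B ε : ℝ) (i : E.V) (j : E'.V) : ℝ :=
  (B + 2) / σ ^ 2 * (ε + E.spuriousShift E' + 4 * E.ratioShift E' i j)

theorem spuriousShift_comm : E.spuriousShift E' = E'.spuriousShift E :=
  Finset.sum_congr rfl fun _ _ => norm_sub_rev _ _

theorem spuriousShift_nonneg : 0 ≤ E.spuriousShift E' :=
  Finset.sum_nonneg fun _ _ => norm_nonneg _

theorem ratioShift_comm (i : E.V) (j : E'.V) : E.ratioShift E' i j = E'.ratioShift E j i :=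
  Finset.sum_congr rfl fun _ _ => Finset.sum_congr rfl fun _ _ => abs_sub_comm _ _

theorem ratioShift_nonneg (i : E.V) (j : E'.V) : 0 ≤ E.ratioShift E' i j :=
  Finset.sum_nonneg fun _ _ => Finset.sum_nonneg fun _ _ => abs_nonneg _

theorem logDensityGap_comm (σ B ε : ℝ) (i : E.V) (j : E'.V) :
    E.logDensityGap E' σ B ε i j = E'.logDensityGap E σ B ε j i := by
  rw [logDensityGap, logDensityGap, spuriousShift_comm, ratioShift_comm]

variable {E E'}

theorem logDensityGap_nonneg {σ B ε : ℝ} (hB : 0 ≤ B) (hε : 0 ≤ ε) (i : E.V) (j : E'.V) :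
    0 ≤ E.logDensityGap E' σ B ε i j := by
  have hsp := E.spuriousShift_nonneg E'
  have hratio := E.ratioShift_nonneg E' i j
  unfold logDensityGap
  positivity

theorem sum_abs_pHt_sub_le_ratioShift (i : E.V) (j : E'.V) (c : Fin C) :
    ∑ c' ∈ Finset.univ.filter (fun c' => c' ≠ c), |E.pHt i c c' - E'.pHt j c c'| ≤
      E.ratioShift E' i j :=
  Finset.single_le_sum (f := fun c => ∑ c' ∈ Finset.univ.filter (fun c' => c' ≠ c),
    |E.pHt i c c' - E'.pHt j c c'|) (fun _ _ => Finset.sum_nonneg fun _ _ => abs_nonneg _)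
    (Finset.mem_univ c)

theorem abs_pHm_sub_pHm_le (i : E.V) (j : E'.V) (c : Fin C) :
    |E.pHm i - E'.pHm j| ≤
      ∑ c' ∈ Finset.univ.filter (fun c' => c' ≠ c), |E.pHt i c c' - E'.pHt j c c'| := by
  have hsub : E.pHm i - E'.pHm j =
      -∑ c' ∈ Finset.univ.filter (fun c' => c' ≠ c), (E.pHt i c c' - E'.pHt j c c') := by
    rw [Finset.sum_sub_distrib]
    linarith [E.sum_ratio i c, E'.sum_ratio j c]
  rw [hsub, abs_neg]
  exact Finset.abs_sum_le_sum_abs _ _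

end Environment

theorem norm_concat_le {d : ℕ} (u v : EuclideanSpace ℝ (Fin d)) : ‖concat u v‖ ≤ ‖u‖ + ‖v‖ := by
  have hsq : ‖concat u v‖ ^ 2 = ‖u‖ ^ 2 + ‖v‖ ^ 2 := by
    simp [EuclideanSpace.norm_sq_eq, concat]
  refine le_of_sq_le_sq ?_ (by positivity)
  rw [hsq]
  nlinarith [norm_nonneg u, norm_nonneg v]

namespace CSBM

variable {d C : ℕ} {σ : ℝ} (M : CSBM d C σ)

section Comparison

variable (E E' : Environment d C)

theorem norm_featMean_le_two (c : Fin C) : ‖M.featMean E c‖ ≤ 2 := by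
  refine (norm_concat_le _ _).trans ?_
  rw [M.orthonormal_mu.1, E.orthonormal_muSp.1]
  norm_num

theorem norm_featMean_sub_le_spuriousShift (c : Fin C) :
    ‖M.featMean E c - M.featMean E' c‖ ≤ E.spuriousShift E' := by
  have hsub : M.featMean E c - M.featMean E' c = concat 0 (E.muSp c - E'.muSp c) := by
    ext (k | k) <;> simp [featMean, concat]
  calc ‖M.featMean E c - M.featMean E' c‖ ≤ ‖E.muSp c - E'.muSp c‖ := by
        simpa only [hsub, norm_zero, zero_add] using norm_concat_le 0 (E.muSp c - E'.muSp c)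
    _ ≤ E.spuriousShift E' := Finset.single_le_sum (f := fun c => ‖E.muSp c - E'.muSp c‖)
        (fun _ _ => norm_nonneg _) (Finset.mem_univ c)

theorem norm_smul_featMean_sub_le (a : ℝ) {b : ℝ} (hb : 0 ≤ b) (c : Fin C) :
    ‖a • M.featMean E c - b • M.featMean E' c‖ ≤ |a - b| * 2 + b * E.spuriousShift E' :=
  (norm_smul_sub_smul_le hb _ _).trans (add_le_add
    (mul_le_mul_of_nonneg_left (M.norm_featMean_le_two E c) (abs_nonneg _))
    (mul_le_mul_of_nonneg_left (M.norm_featMean_sub_le_spuriousShift E E' c) hb))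

theorem norm_aggMean_le_two (i : E.V) (c : Fin C) : ‖M.aggMean E i c‖ ≤ 2 := by
  have hsmul : ∀ {a : ℝ}, 0 ≤ a → ∀ c', ‖a • M.featMean E c'‖ ≤ a * 2 := fun {a} ha c' => by
    rw [norm_smul, Real.norm_of_nonneg ha]
    exact mul_le_mul_of_nonneg_left (M.norm_featMean_le_two E c') ha
  calc ‖M.aggMean E i c‖
      ≤ E.pHm i * 2 + ∑ c' ∈ Finset.univ.filter (fun c' => c' ≠ c), E.pHt i c c' * 2 :=
        (norm_add_le _ _).trans (add_le_add (hsmul (E.pHm_nonneg i) c)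
          ((norm_sum_le _ _).trans (Finset.sum_le_sum fun c' hc' =>
            hsmul (E.pHt_nonneg i c c' (Finset.mem_filter.1 hc').2) c')))
    _ = 2 := by rw [← Finset.sum_mul, ← add_mul, E.sum_ratio, one_mul]

theorem norm_aggMean_sub_le (i : E.V) (j : E'.V) (c : Fin C) :
    ‖M.aggMean E i c - M.aggMean E' j c‖ ≤ E.spuriousShift E' + 4 * E.ratioShift E' i j := by
  set S := E.spuriousShift E'
  set ρ := ∑ c' ∈ Finset.univ.filter (fun c' => c' ≠ c), |E.pHt i c c' - E'.pHt j c c'|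
  have hsplit : M.aggMean E i c - M.aggMean E' j c =
      (E.pHm i • M.featMean E c - E'.pHm j • M.featMean E' c) +
      ∑ c' ∈ Finset.univ.filter (fun c' => c' ≠ c),
        (E.pHt i c c' • M.featMean E c' - E'.pHt j c c' • M.featMean E' c') := by
    rw [Finset.sum_sub_distrib, aggMean, aggMean]
    abel
  calc ‖M.aggMean E i c - M.aggMean E' j c‖
      ≤ (|E.pHm i - E'.pHm j| * 2 + E'.pHm j * S) +
        ∑ c' ∈ Finset.univ.filter (fun c' => c' ≠ c),
          (|E.pHt i c c' - E'.pHt j c c'| * 2 + E'.pHt j c c' * S) := by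
        rw [hsplit]
        refine (norm_add_le _ _).trans (add_le_add
          (M.norm_smul_featMean_sub_le E E' _ (E'.pHm_nonneg j) c)
          ((norm_sum_le _ _).trans (Finset.sum_le_sum fun c' hc' => ?_)))
        exact M.norm_smul_featMean_sub_le E E' _
          (E'.pHt_nonneg j c c' (Finset.mem_filter.1 hc').2) c'
    _ = |E.pHm i - E'.pHm j| * 2 + ρ * 2 + (E'.pHm j +
        ∑ c' ∈ Finset.univ.filter (fun c' => c' ≠ c), E'.pHt j c c') * S := by
        rw [Finset.sum_add_distrib, ← Finset.sum_mul, ← Finset.sum_mul]; ring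
    _ ≤ S + 4 * E.ratioShift E' i j := by
        rw [E'.sum_ratio]
        linarith [Environment.abs_pHm_sub_pHm_le i j c,
          Environment.sum_abs_pHt_sub_le_ratioShift i j c]

variable {E E'}

theorem norm_agg_sub_aggMean_le {B : ℝ} {i : E.V} (hi : ‖E.agg i‖ ≤ B) (c : Fin C) :
    ‖E.agg i - M.aggMean E i c‖ ≤ B + 2 :=
  (norm_sub_le _ _).trans (add_le_add hi (M.norm_aggMean_le_two E i c))

variable {B ε : ℝ} {i : E.V} {j : E'.V}

theorem density_le_exp_mul_density (hσ : 0 < σ) (hi : ‖E.agg i‖ ≤ B) (hj : ‖E'.agg j‖ ≤ B)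
    (hij : ‖E.agg i - E'.agg j‖ ≤ ε) (c : Fin C) :
    M.density E i c (E.agg i) ≤
      Real.exp (E.logDensityGap E' σ B ε i j) * M.density E' j c (E'.agg j) := by
  have hB : 0 ≤ B := (norm_nonneg _).trans hi
  have hdist : ‖E.agg i - M.aggMean E i c - (E'.agg j - M.aggMean E' j c)‖ ≤
      ε + E.spuriousShift E' + 4 * E.ratioShift E' i j := by
    rw [sub_sub_sub_comm, add_assoc]
    exact (norm_sub_le _ _).trans (add_le_add hij (M.norm_aggMean_sub_le E E' i j c))
  have hgap : (B + 2) / σ ^ 2 * ‖E.agg i - M.aggMean E i c - (E'.agg j - M.aggMean E' j c)‖ ≤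
      E.logDensityGap E' σ B ε i j :=
    mul_le_mul_of_nonneg_left hdist (by positivity)
  have hexp := exp_neg_sq_norm_div_le (pow_pos hσ 2) (M.norm_agg_sub_aggMean_le hi c)
    (M.norm_agg_sub_aggMean_le hj c)
  unfold density
  rw [mul_left_comm]
  gcongr
  exact hexp.trans (by gcongr)

theorem posterior_sub_posterior_le (hσ : 0 < σ) (hi : ‖E.agg i‖ ≤ B) (hj : ‖E'.agg j‖ ≤ B)
    (hij : ‖E.agg i - E'.agg j‖ ≤ ε) (c : Fin C) :
    M.posterior E i c - M.posterior E' j c ≤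
      2 * E.logDensityGap E' σ B ε i j * M.posterior E i c := by
  rw [posterior_eq_density_div_sum, posterior_eq_density_div_sum]
  refine div_sum_sub_div_sum_le (fun c => M.density_pos E hσ i c _)
    (fun c => M.density_pos E' hσ j c _) (M.density_le_exp_mul_density hσ hi hj hij) ?_ c
  rw [E.logDensityGap_comm E']
  exact M.density_le_exp_mul_density hσ hj hi (by rwa [norm_sub_rev])

end Comparison

end CSBM

theorem Environment.size_pos {d C : ℕ} (E : Environment d C) : (0 : ℝ) < E.size :=
  Nat.cast_pos.2 (Fintype.card_pos : 0 < Fintype.card E.V)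

/-! ### Near sets -/

namespace CSBM

variable {d C : ℕ} {σ : ℝ} (M : CSBM d C σ) (e : M.Test)

theorem norm_agg_train_le_maxNorm (i : M.train.V) : ‖M.train.agg i‖ ≤ M.maxNorm e :=
  (le_ciSup (f := fun i => ‖M.train.agg i‖) (Set.finite_range _).bddAbove i).trans
    (le_max_left _ _)

theorem norm_agg_test_le_maxNorm (j : (M.test e).V) : ‖(M.test e).agg j‖ ≤ M.maxNorm e :=
  (le_ciSup (f := fun j => ‖(M.test e).agg j‖) (Set.finite_range _).bddAbove j).trans
    (le_max_right _ _)

theorem dist_nonneg : 0 ≤ M.dist e :=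
  Real.iSup_nonneg fun _ => Real.iInf_nonneg fun _ => norm_nonneg _

theorem dist_le_two_mul_maxNorm : M.dist e ≤ 2 * M.maxNorm e := by
  refine ciSup_le fun j => ?_
  obtain ⟨i⟩ := M.train.nonemptyV
  refine (ciInf_le (Set.finite_range _).bddBelow i).trans ((norm_sub_le _ _).trans ?_)
  linarith [M.norm_agg_train_le_maxNorm e i, M.norm_agg_test_le_maxNorm e j]

theorem mem_near {i : M.train.V} {j : (M.test e).V} :
    j ∈ M.near e i ↔ ‖M.train.agg i - (M.test e).agg j‖ ≤ M.dist e := by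
  simp [near]

theorem exists_mem_near (j : (M.test e).V) : ∃ i, j ∈ M.near e i := by
  obtain ⟨i, hi⟩ := exists_eq_ciInf_of_finite
    (f := fun i : M.train.V => ‖M.train.agg i - (M.test e).agg j‖)
  refine ⟨i, (M.mem_near e).2 (hi.trans_le ?_)⟩
  exact le_ciSup (f := fun j : (M.test e).V => ⨅ i : M.train.V,
    ‖M.train.agg i - (M.test e).agg j‖) (Set.finite_range _).bddAbove j

variable {M e} {s : ℕ}

theorem NearSets.sum_eq (h : M.NearSets e s) (f : (M.test e).V → ℝ) :
    ∑ j, f j = ∑ i, ∑ j ∈ M.near e i, f j := by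
  classical
  rw [← Finset.sum_biUnion fun i _ i' _ hii => h.2.2 i i' hii]
  refine Finset.sum_congr ?_ fun _ _ => rfl
  ext j
  simpa using M.exists_mem_near e j

theorem NearSets.size_test (h : M.NearSets e s) :
    ((M.test e).size : ℝ) = M.train.size * s := by
  simpa [h.2.1, Environment.size] using h.sum_eq fun _ => 1

theorem NearSets.average_eq (h : M.NearSets e s) (f : (M.test e).V → ℝ) :
    (1 / ((M.test e).size : ℝ)) * ∑ j, f j =
      (1 / (M.train.size : ℝ)) * ∑ i, (1 / (s : ℝ)) * ∑ j ∈ M.near e i, f j := by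
  rw [h.size_test, h.sum_eq, ← Finset.mul_sum, ← mul_assoc, one_div_mul_one_div]

theorem NearSets.average_const (h : M.NearSets e s) (a : ℝ) (i : M.train.V) :
    (1 / (s : ℝ)) * ∑ _j ∈ M.near e i, a = a := by
  have hs : (s : ℝ) ≠ 0 := Nat.cast_ne_zero.2 h.1.ne'
  rw [Finset.sum_const, h.2.1, nsmul_eq_mul, one_div_mul_eq_div, mul_div_cancel_left₀ _ hs]

/-! ### The terms of the bound -/

variable (M e)

theorem two_div_sq_mul_dist_le_termA (hC : 2 ≤ C) : 2 / σ ^ 2 * M.dist e ≤ M.termA e := by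
  have : Nontrivial (Fin C) := Fin.nontrivial_iff_two_le.2 hC
  obtain ⟨c, c', hc⟩ := exists_pair_ne (Fin C)
  set f : Fin C → Fin C → ℝ := fun c c' =>
    Real.sqrt ‖concat (M.mu c - M.mu c') ((M.test e).muSp c - (M.test e).muSp c')‖ +
      2 * Real.sqrt 2
  have hf : ∀ c c', 0 ≤ f c c' := fun c c' => by positivity
  have htwo : 2 ≤ f c c' := by
    have : 1 ≤ Real.sqrt 2 := Real.one_le_sqrt.2 one_le_two
    have := Real.sqrt_nonneg
      ‖concat (M.mu c - M.mu c') ((M.test e).muSp c - (M.test e).muSp c')‖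
    linarith
  have hsum : 2 ≤ ∑ c, ∑ c' ∈ Finset.univ.filter (fun c' => c' ≠ c), f c c' :=
    calc (2 : ℝ) ≤ f c c' := htwo
      _ ≤ ∑ c' ∈ Finset.univ.filter (fun c' => c' ≠ c), f c c' :=
        Finset.single_le_sum (fun c' _ => hf c c')
          (Finset.mem_filter.2 ⟨Finset.mem_univ c', hc.symm⟩)
      _ ≤ ∑ c, ∑ c' ∈ Finset.univ.filter (fun c' => c' ≠ c), f c c' :=
        Finset.single_le_sum (f := fun c => ∑ c' ∈ Finset.univ.filter (fun c' => c' ≠ c), f c c')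
          (fun c _ => Finset.sum_nonneg fun c' _ => hf c c') (Finset.mem_univ c)
  calc 2 / σ ^ 2 * M.dist e = 1 / σ ^ 2 * (2 * M.dist e) := by ring
    _ ≤ M.termA e := mul_le_mul_of_nonneg_left
      (mul_le_mul_of_nonneg_right hsum (M.dist_nonneg e)) (by positivity)

theorem termA_nonneg : 0 ≤ M.termA e := by
  have := M.dist_nonneg e
  unfold termA
  positivity

theorem maxNorm_nonneg : 0 ≤ M.maxNorm e := by
  linarith [M.dist_nonneg e, M.dist_le_two_mul_maxNorm e]

theorem two_mul_maxNorm_mul_spuriousShift_le_termB (hC : 2 ≤ C) :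
    2 * M.maxNorm e / σ ^ 2 * (M.test e).spuriousShift M.train ≤ M.termB e := by
  have hC' : (1 : ℝ) ≤ C - 1 := by
    have : (2 : ℝ) ≤ C := Nat.ofNat_le_cast.2 hC
    linarith
  calc 2 * M.maxNorm e / σ ^ 2 * (M.test e).spuriousShift M.train
      = 1 / σ ^ 2 *
        (2 * ∑ c, 1 * M.maxNorm e * ‖(M.test e).muSp c - M.train.muSp c‖) := by
        rw [← Finset.mul_sum, Environment.spuriousShift]; ring
    _ ≤ M.termB e := by
        have := M.maxNorm_nonneg e
        unfold termB
        gcongr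

theorem termB_nonneg (hC : 2 ≤ C) : 0 ≤ M.termB e :=
  (mul_nonneg (div_nonneg (mul_nonneg zero_le_two (M.maxNorm_nonneg e)) (sq_nonneg σ))
    (Environment.spuriousShift_nonneg _ _)).trans
    (M.two_mul_maxNorm_mul_spuriousShift_le_termB e hC)

theorem termC_nonneg (s : ℕ) : 0 ≤ M.termC e s := by
  unfold termC
  positivity

theorem termC_eq_average_ratioShift (s : ℕ) :
    M.termC e s = 1 / (2 * σ ^ 2) * ((1 / (M.train.size : ℝ)) * ∑ i,
      (1 / (s : ℝ)) * ∑ j ∈ M.near e i, (M.test e).ratioShift M.train j i) :=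
  rfl

/-! ### The loss discrepancy -/

section Discrepancy

variable {ks : List ℕ} {γ γ' η : ℝ} {W : Params C (Fin d ⊕ Fin d) ks}

theorem nodeLoss_le_nodeLoss_add (hσ : 0 < σ) {E E' : Environment d C} {i : E.V} {j : E'.V}
    {B ε : ℝ} (hi : ‖E.agg i‖ ≤ B) (hj : ‖E'.agg j‖ ≤ B) (hij : ‖E.agg i - E'.agg j‖ ≤ ε)
    (hC : 0 < C) (hW : Params.maxSpecNorm ks W ^ depth ks * ε ≤ η) (hγ : γ + 2 * η ≤ γ') :
    M.nodeLoss E γ W i ≤ M.nodeLoss E' γ' W j + 2 * E.logDensityGap E' σ B ε i j := by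
  have hgap : 0 ≤ E.logDensityGap E' σ B ε i j :=
    Environment.logDensityGap_nonneg ((norm_nonneg _).trans hi) ((norm_nonneg _).trans hij) i j
  have hlogits : ∀ c, |logits E ks W i c - logits E' ks W j c| ≤ η := fun c =>
    (abs_logits_sub_logits_le E E' W i j c).trans ((mul_le_mul_of_nonneg_left hij
      (pow_nonneg (Params.maxSpecNorm_nonneg ks W) _)).trans hW)
  calc M.nodeLoss E γ W i
      ≤ ∑ c, M.posterior E i c * marginLoss γ' (logits E' ks W j) c :=
        Finset.sum_le_sum fun c _ => mul_le_mul_of_nonneg_left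
          (marginLoss_le_marginLoss hlogits hγ c) (M.posterior_nonneg E i c)
    _ ≤ ∑ c, (M.posterior E' j c * marginLoss γ' (logits E' ks W j) c +
          2 * E.logDensityGap E' σ B ε i j * M.posterior E i c) := by
        refine Finset.sum_le_sum fun c _ => ?_
        have hpost := mul_le_mul_of_nonneg_right (M.posterior_sub_posterior_le hσ hi hj hij c)
          (marginLoss_nonneg γ' (logits E' ks W j) c)
        have hone := mul_le_mul_of_nonneg_left (marginLoss_le_one γ' (logits E' ks W j) c)
          (mul_nonneg (mul_nonneg zero_le_two hgap) (M.posterior_nonneg E i c))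
        linarith
    _ = M.nodeLoss E' γ' W j + 2 * E.logDensityGap E' σ B ε i j := by
        rw [Finset.sum_add_distrib, ← Finset.mul_sum, M.sum_posterior E hC hσ, mul_one, nodeLoss]

theorem expLoss_test_le_expLoss_train_add_average (hC : 0 < C) (hσ : 0 < σ) {s : ℕ}
    (hs : M.NearSets e s) (hW : Params.maxSpecNorm ks W ^ depth ks * M.dist e ≤ η)
    (hγ : γ + 2 * η ≤ γ') :
    M.expLoss (M.test e) ks γ W ≤ M.expLoss M.train ks γ' W +
      (1 / (M.train.size : ℝ)) * ∑ i, (1 / (s : ℝ)) * ∑ j ∈ M.near e i,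
        2 * (M.test e).logDensityGap M.train σ (M.maxNorm e) (M.dist e) j i := by
  rw [M.expLoss_eq_average_nodeLoss _ hC hσ, M.expLoss_eq_average_nodeLoss _ hC hσ, hs.average_eq,
    ← mul_add, ← Finset.sum_add_distrib]
  gcongr with i
  rw [← hs.average_const (M.nodeLoss M.train γ' W i) i, ← mul_add, ← Finset.sum_add_distrib]
  gcongr with j hj
  refine M.nodeLoss_le_nodeLoss_add hσ (M.norm_agg_test_le_maxNorm e j)
    (M.norm_agg_train_le_maxNorm e i) ?_ hC hW hγ
  rw [norm_sub_rev]
  exact (M.mem_near e).1 hj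

theorem average_logDensityGap_eq {s : ℕ} (hs : M.NearSets e s) (B ε : ℝ) :
    (1 / (M.train.size : ℝ)) * ∑ i, (1 / (s : ℝ)) * ∑ j ∈ M.near e i,
        2 * (M.test e).logDensityGap M.train σ B ε j i =
      (B + 2) * (2 / σ ^ 2 * ε) + (B + 2) * (2 / σ ^ 2 * (M.test e).spuriousShift M.train) +
        16 * (B + 2) * M.termC e s := by
  have hN : (M.train.size : ℝ) ≠ 0 := M.train.size_pos.ne'
  have hterm : ∀ i, (1 / (s : ℝ)) * ∑ j ∈ M.near e i,
      2 * (M.test e).logDensityGap M.train σ B ε j i =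
      (B + 2) * (2 / σ ^ 2 * ε) + (B + 2) * (2 / σ ^ 2 * (M.test e).spuriousShift M.train) +
        8 * (B + 2) / σ ^ 2 *
          ((1 / (s : ℝ)) * ∑ j ∈ M.near e i, (M.test e).ratioShift M.train j i) := fun i => by
    rw [← hs.average_const ((B + 2) * (2 / σ ^ 2 * ε) +
      (B + 2) * (2 / σ ^ 2 * (M.test e).spuriousShift M.train)) i, mul_left_comm (8 * _ / _),
      ← mul_add, Finset.mul_sum (M.near e i) _ (8 * _ / _), ← Finset.sum_add_distrib]
    refine congrArg _ (Finset.sum_congr rfl fun j _ => ?_)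
    rw [Environment.logDensityGap]
    ring
  have hcard : (Fintype.card M.train.V : ℝ) = M.train.size := rfl
  rw [Finset.sum_congr rfl fun i _ => hterm i, Finset.sum_add_distrib, Finset.sum_const,
    Finset.card_univ, nsmul_eq_mul, hcard, ← Finset.mul_sum, M.termC_eq_average_ratioShift]
  field_simp
  ring

/-- The constant of the bound of the expected loss discrepancy, in terms of the largest norm of an
aggregated feature; the summands account for the terms (a) and (c), and for the term (b). -/
def discrepancyConst (B : ℝ) : ℝ := 16 * (B + 2) + (B + 2) / B

theorem discrepancyConst_nonneg {B : ℝ} (hB : 0 ≤ B) : 0 ≤ discrepancyConst B := by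
  unfold discrepancyConst
  positivity

theorem expLoss_test_le (hC : 2 ≤ C) (hσ : 0 < σ) {s : ℕ} (hB : 0 < M.maxNorm e)
    (hs : M.NearSets e s) (hW : Params.maxSpecNorm ks W ^ depth ks * M.dist e ≤ η)
    (hγ : γ + 2 * η ≤ γ') :
    M.expLoss (M.test e) ks γ W ≤ M.expLoss M.train ks γ' W +
      discrepancyConst (M.maxNorm e) * (M.termA e + M.termB e + M.termC e s) := by
  refine (M.expLoss_test_le_expLoss_train_add_average e (by omega) hσ hs hW hγ).trans ?_
  rw [M.average_logDensityGap_eq e hs]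
  set B := M.maxNorm e
  have hA : (B + 2) * (2 / σ ^ 2 * M.dist e) ≤ (B + 2) * M.termA e :=
    mul_le_mul_of_nonneg_left (M.two_div_sq_mul_dist_le_termA e hC) (by positivity)
  have hshift : (B + 2) * (2 / σ ^ 2 * (M.test e).spuriousShift M.train) ≤
      (B + 2) / B * M.termB e :=
    calc (B + 2) * (2 / σ ^ 2 * (M.test e).spuriousShift M.train)
        = (B + 2) / B * (2 * B / σ ^ 2 * (M.test e).spuriousShift M.train) := by field_simp
      _ ≤ (B + 2) / B * M.termB e := mul_le_mul_of_nonneg_left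
          (M.two_mul_maxNorm_mul_spuriousShift_le_termB e hC) (by positivity)
  have hquot : 0 ≤ (B + 2) / B := by positivity
  have hA0 := M.termA_nonneg e
  have hB0 := M.termB_nonneg e hC
  have hC0 := M.termC_nonneg e s
  unfold discrepancyConst
  nlinarith [mul_nonneg hquot hA0, mul_nonneg hquot hC0, mul_nonneg hB.le hA0,
    mul_nonneg hB.le hB0]

end Discrepancy

end CSBM

theorem log_integral_exp_le_of_ae_le {Ω : Type*} [MeasurableSpace Ω] {P : Measure Ω}
    [IsProbabilityMeasure P] {f : Ω → ℝ} {a : ℝ} (ha : 0 ≤ a) (hf : ∀ᵐ x ∂P, f x ≤ a) :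
    Real.log (∫ x, Real.exp (f x) ∂P) ≤ a := by
  have hint : ∫ x, Real.exp (f x) ∂P ≤ Real.exp a :=
    calc ∫ x, Real.exp (f x) ∂P ≤ ∫ _, Real.exp a ∂P :=
          integral_mono_of_nonneg (.of_forall fun _ => (Real.exp_pos _).le) (integrable_const _)
            (hf.mono fun _ hx => Real.exp_le_exp.2 hx)
      _ = Real.exp a := by simp
  have hnonneg : 0 ≤ ∫ x, Real.exp (f x) ∂P := integral_nonneg fun x => (Real.exp_pos (f x)).le
  rcases hnonneg.eq_or_lt with hzero | hpos
  · rwa [← hzero, Real.log_zero]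
  · exact (Real.log_le_log hpos hint).trans_eq (Real.log_exp a)

theorem CSBM.discrepancy_le {d C : ℕ} {σ : ℝ} (M : CSBM d C σ) (e : M.Test) (hC : 2 ≤ C)
    (hσ : 0 < σ) {s : ℕ} (hB : 0 < M.maxNorm e) (hs : M.NearSets e s) {ks : List ℕ} {γ lam : ℝ}
    (hlam : 0 ≤ lam) {P : Measure (Params C (Fin d ⊕ Fin d) ks)} [IsProbabilityMeasure P]
    (hP : ∀ᵐ W ∂P, Params.maxSpecNorm ks W ^ depth ks * M.dist e ≤ γ / 4) :
    M.discrepancy e ks γ lam P ≤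
      lam * (discrepancyConst (M.maxNorm e) * (M.termA e + M.termB e + M.termC e s)) := by
  have hsum : 0 ≤ M.termA e + M.termB e + M.termC e s :=
    add_nonneg (add_nonneg (M.termA_nonneg e) (M.termB_nonneg e hC)) (M.termC_nonneg e s)
  refine log_integral_exp_le_of_ae_le
    (mul_nonneg hlam (mul_nonneg (discrepancyConst_nonneg hB.le) hsum)) (hP.mono fun W hW => ?_)
  have := M.expLoss_test_le e hC hσ hB hs hW (γ := γ / 2) (γ' := γ) (by linarith)
  exact mul_le_mul_of_nonneg_left (by linarith) hlam

/-! ### Uniform deviation of the empirical margin loss -/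

theorem exists_forall_abs_logits_sub_le {d C : ℕ} (ks : List ℕ) (R B : ℝ) {η : ℝ} (hη : 0 < η) :
    ∃ ρ > 0, ∀ W W' : Params C (Fin d ⊕ Fin d) ks, ‖W‖ ≤ R → ‖W'‖ ≤ R → Dist.dist W W' ≤ ρ →
      ∀ (E : Environment d C) (i : E.V), ‖E.agg i‖ ≤ B →
        ∀ c, |logits E ks W i c - logits E ks W' i c| ≤ η := by
  obtain ⟨ρ, hρ, h⟩ := Params.exists_abs_apply_sub_apply_le (C := C) (ι := Fin d ⊕ Fin d) ks R B hη
  exact ⟨ρ, hρ, fun W W' hW hW' hWW E i hi => h W W' hW hW' hWW _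
    ((pi_norm_le_iff_of_nonneg (norm_nonneg _)).2 (PiLp.norm_apply_le (E.agg i)) |>.trans hi)⟩

namespace CSBM

variable {d C : ℕ} {σ : ℝ} (M : CSBM d C σ) (E : Environment d C)

theorem isProbabilityMeasure_labelLaw (hC : 0 < C) (hσ : 0 < σ) :
    IsProbabilityMeasure (M.labelLaw E) := by
  have := M.isProbabilityMeasure_nodeLabelLaw E hC hσ
  unfold labelLaw
  infer_instance

variable {ks : List ℕ}

theorem variance_empLoss_le (hC : 0 < C) (hσ : 0 < σ) (γ : ℝ)
    (W : Params C (Fin d ⊕ Fin d) ks) :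
    variance (empLoss E ks γ W) (M.labelLaw E) ≤ 1 / (4 * E.size) := by
  have := M.isProbabilityMeasure_nodeLabelLaw E hC hσ
  have hsize : (Fintype.card E.V : ℝ) = E.size := rfl
  have hsize0 : (E.size : ℝ) ≠ 0 := E.size_pos.ne'
  have hsum : empLoss E ks γ W = fun y => (1 / (E.size : ℝ)) *
      (∑ i, fun y : E.V → Fin C => marginLoss γ (logits E ks W i) (y i)) y := by
    funext y
    rw [empLoss, Finset.sum_apply]
  have hnode : ∀ i, variance (marginLoss γ (logits E ks W i)) (M.nodeLabelLaw E i) ≤ 1 / 4 :=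
    fun i => (variance_le_sq_of_bounded (a := 0) (b := 1) (.of_forall fun c =>
      ⟨marginLoss_nonneg _ _ _, marginLoss_le_one _ _ _⟩) (by fun_prop)).trans (by norm_num)
  rw [hsum, variance_const_mul, labelLaw,
    variance_sum_pi (X := fun i => marginLoss γ (logits E ks W i)) fun i => MemLp.of_discrete]
  calc (1 / (E.size : ℝ)) ^ 2 *
          ∑ i, variance (marginLoss γ (logits E ks W i)) (M.nodeLabelLaw E i)
      ≤ (1 / (E.size : ℝ)) ^ 2 * ∑ _i : E.V, (1 / 4 : ℝ) := by
        gcongr with i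
        exact hnode i
    _ = 1 / (4 * (E.size : ℝ)) := by
        rw [Finset.sum_const, Finset.card_univ, nsmul_eq_mul, hsize]
        field_simp

theorem labelLaw_le_expLoss_sub_empLoss (hC : 0 < C) (hσ : 0 < σ) (γ : ℝ)
    (W : Params C (Fin d ⊕ Fin d) ks) {t : ℝ} (ht : 0 < t) :
    (M.labelLaw E).real {y | t ≤ M.expLoss E ks γ W - empLoss E ks γ W y} ≤
      1 / (4 * E.size * t ^ 2) := by
  have := M.isProbabilityMeasure_labelLaw E hC hσ
  have hchebyshev := meas_ge_le_variance_div_sq (μ := M.labelLaw E) (X := empLoss E ks γ W)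
    MemLp.of_discrete ht
  refine ENNReal.toReal_le_of_le_ofReal (by positivity)
    ((measure_mono fun y hy => ?_).trans (hchebyshev.trans (ENNReal.ofReal_le_ofReal ?_)))
  · change t ≤ |empLoss E ks γ W y - M.expLoss E ks γ W|
    rw [abs_sub_comm]
    exact le_trans hy (le_abs_self _)
  · rw [← div_div]
    exact div_le_div_of_nonneg_right (M.variance_empLoss_le E hC hσ γ W) (by positivity)

theorem le_labelLaw_forall_mem (hC : 0 < C) (hσ : 0 < σ) (γ : ℝ)
    (F : Finset (Params C (Fin d ⊕ Fin d) ks)) {t : ℝ} (ht : 0 < t) :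
    1 - F.card * (1 / (4 * E.size * t ^ 2)) ≤
      (M.labelLaw E).real {y | ∀ W ∈ F, M.expLoss E ks γ W < empLoss E ks γ W y + t} := by
  have := M.isProbabilityMeasure_labelLaw E hC hσ
  have hcompl : {y | ∀ W ∈ F, M.expLoss E ks γ W < empLoss E ks γ W y + t}ᶜ =
      ⋃ W ∈ F, {y | t ≤ M.expLoss E ks γ W - empLoss E ks γ W y} := by
    ext y
    simp [le_sub_iff_add_le']
  have hbad : (M.labelLaw E).real
      {y | ∀ W ∈ F, M.expLoss E ks γ W < empLoss E ks γ W y + t}ᶜ ≤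
      F.card * (1 / (4 * E.size * t ^ 2)) := by
    rw [hcompl, ← nsmul_eq_mul]
    exact (measureReal_biUnion_finset_le F _).trans (Finset.sum_le_card_nsmul _ _ _ fun W _ =>
      M.labelLaw_le_expLoss_sub_empLoss E hC hσ γ W ht)
  rw [probReal_compl_eq_one_sub (Set.toFinite _).measurableSet] at hbad
  linarith

/- A finite net of the ball of weights reduces the uniform bound to finitely many perceptrons; the
logits are uniformly continuous in the weights, and the slack `γ' - γ` absorbs their variation. -/
theorem exists_le_labelLaw_forall (d : ℕ) (hC : 0 < C) (hσ : 0 < σ) (ks : List ℕ) (R B : ℝ)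
    {γ γ' : ℝ} (hγ : γ < γ') :
    ∃ n : ℕ, ∀ (M : CSBM d C σ) (E : Environment d C), (∀ i, ‖E.agg i‖ ≤ B) → ∀ t : ℝ, 0 < t →
      1 - n * (1 / (4 * E.size * t ^ 2)) ≤
        (M.labelLaw E).real {y | ∀ W : Params C (Fin d ⊕ Fin d) ks,
          Params.maxSpecNorm ks W ≤ R → M.expLoss E ks γ W ≤ empLoss E ks γ' W y + t} := by
  obtain ⟨ρ, hρ, hclose⟩ := exists_forall_abs_logits_sub_le (d := d) (C := C) ks R B
    (show 0 < (γ' - γ) / 4 by linarith)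
  obtain ⟨F, hFR, hF, hcover⟩ :=
    (isCompact_closedBall (0 : Params C (Fin d ⊕ Fin d) ks) R).finite_cover_balls hρ
  refine ⟨hF.toFinset.card, fun M E hE t ht => ?_⟩
  have := M.isProbabilityMeasure_labelLaw E hC hσ
  refine (M.le_labelLaw_forall_mem E hC hσ ((γ + γ') / 2) hF.toFinset ht).trans
    (measureReal_mono fun y hy W hW => ?_)
  have hWR : ‖W‖ ≤ R := (Params.norm_le_maxSpecNorm ks W).trans hW
  obtain ⟨W', hW', hWW⟩ := Set.mem_iUnion₂.1 (hcover (mem_closedBall_zero_iff.2 hWR))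
  have hlogits : ∀ i c, |logits E ks W i c - logits E ks W' i c| ≤ (γ' - γ) / 4 := fun i =>
    hclose W W' hWR (mem_closedBall_zero_iff.1 (hFR hW')) (Metric.mem_ball.1 hWW).le E i (hE i)
  calc M.expLoss E ks γ W ≤ M.expLoss E ks ((γ + γ') / 2) W' :=
        M.expLoss_le_expLoss E hlogits (by linarith)
    _ ≤ empLoss E ks ((γ + γ') / 2) W' y + t := (hy W' (hF.mem_toFinset.2 hW')).le
    _ ≤ empLoss E ks γ' W y + t := by
        gcongr
        exact empLoss_le_empLoss (fun i c => (abs_sub_comm _ _).trans_le (hlogits i c))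
          (by linarith) y

end CSBM

/-! ### Mass of small balls for the Gaussian prior -/

open Filter in
theorem eventually_exp_neg_sq_lt {a : ℝ} (ha : 0 < a) (b : ℝ) (n : ℕ) :
    ∀ᶠ x : ℝ in atTop, Real.exp (-x ^ 2) < (a * Real.exp (-(b * x))) ^ n := by
  have htendsto : Tendsto (fun x : ℝ => x * (x - n * b)) atTop atTop :=
    tendsto_id.atTop_mul_atTop₀ (tendsto_atTop_add_const_right _ _ tendsto_id)
  filter_upwards [htendsto.eventually_gt_atTop (-(n * Real.log a))] with x hx
  have hexp : (a * Real.exp (-(b * x))) ^ n = Real.exp (n * (Real.log a - b * x)) := by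
    rw [Real.exp_nat_mul, sub_eq_add_neg, Real.exp_add, Real.exp_log ha]
  rw [hexp, Real.exp_lt_exp]
  linarith

theorem eventually_atTop_natCast_rpow {p : ℝ → Prop} {α : ℝ} (hα : 0 < α)
    (h : ∀ᶠ x : ℝ in Filter.atTop, p x) : ∀ᶠ N : ℕ in Filter.atTop, p ((N : ℝ) ^ α) :=
  ((tendsto_rpow_atTop hα).comp tendsto_natCast_atTop_atTop).eventually h

namespace Params

variable {C : ℕ}

theorem eventually_exp_neg_rpow_lt_gaussian_closedBall {ι : Type} [Fintype ι] (ks : List ℕ)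
    (R a : ℝ) {V r α : ℝ} (hV : 0 < V) (hr : 0 < r) (hα : 0 < α) :
    ∀ᶠ N : ℕ in Filter.atTop, ∀ v : NNReal, v ≠ 0 → v ≤ V → 1 / (v : ℝ) ≤ a * (N : ℝ) ^ α →
      ∀ W : Params C ι ks, ‖W‖ ≤ R →
        Real.exp (-(N : ℝ) ^ (2 * α)) < (gaussian v ks).real (Metric.closedBall W r) := by
  filter_upwards [eventually_atTop_natCast_rpow hα (eventually_exp_neg_sq_lt
    (a := 2 * r * (Real.sqrt (2 * Real.pi * V))⁻¹) (by positivity) ((R + r) ^ 2 / 2 * a)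
    (numWeights C ι ks))] with N hN v hv hvV hva W hW
  set p := 2 * r * (Real.sqrt (2 * Real.pi * V))⁻¹ *
    Real.exp (-((R + r) ^ 2 / 2 * a * (N : ℝ) ^ α)) with hp
  have hp0 : 0 ≤ p := by positivity
  have : (0 : ℝ) < v := NNReal.coe_pos.2 (pos_iff_ne_zero.2 hv)
  have hexponent : (R + r) ^ 2 / (2 * v) ≤ (R + r) ^ 2 / 2 * a * (N : ℝ) ^ α :=
    calc (R + r) ^ 2 / (2 * v) = (R + r) ^ 2 / 2 * (1 / v) := by field_simp
      _ ≤ (R + r) ^ 2 / 2 * (a * (N : ℝ) ^ α) := by gcongr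
      _ = (R + r) ^ 2 / 2 * a * (N : ℝ) ^ α := by ring
  have hball : ∀ x : ℝ, |x| ≤ R →
      ENNReal.ofReal p ≤ gaussianReal 0 v (Metric.closedBall x r) := fun x hx => by
    refine (ENNReal.ofReal_le_ofReal ?_).trans (le_gaussianReal_closedBall hv hx)
    rw [hp, mul_assoc, neg_div]
    gcongr
  have hpow : p ^ numWeights C ι ks ≤ (gaussian v ks).real (Metric.closedBall W r) := by
    refine (ENNReal.ofReal_le_iff_le_toReal (measure_ne_top _ _)).1 ?_
    rw [ENNReal.ofReal_pow hp0]
    exact pow_numWeights_le_gaussian_closedBall hr.le hball ks W hW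
  calc Real.exp (-(N : ℝ) ^ (2 * α)) = Real.exp (-((N : ℝ) ^ α) ^ 2) := by
        rw [← Real.rpow_mul_natCast N.cast_nonneg, mul_comm α, Nat.cast_ofNat]
    _ < p ^ numWeights C ι ks := hN
    _ ≤ (gaussian v ks).real (Metric.closedBall W r) := hpow

/- A ball around `W` itself would leave the region of weights whose norm is at least that of `W`;
the ball around the dilation `(1 + θ) • W` does not, once its radius is small against `θ * τ`. -/
theorem exists_closedBall_subset {ι : Type} [Fintype ι] [DecidableEq ι] (ks : List ℕ) {R ρ τ : ℝ}
    (hR : 0 ≤ R) (hρ : 0 < ρ) (hτ : 0 < τ) :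
    ∃ r > 0, ∀ W : Params C ι ks, τ < maxSpecNorm ks W → maxSpecNorm ks W ≤ R →
      ∃ W₁, Metric.closedBall W₁ r ⊆
        Metric.closedBall W ρ ∩ {W' | maxSpecNorm ks W ≤ maxSpecNorm ks W'} := by
  set θ := ρ / (2 * (R + 1))
  have hθ : 0 < θ := by positivity
  have hθR : θ * R ≤ ρ / 2 :=
    calc θ * R ≤ θ * (R + 1) := by gcongr; linarith
      _ = ρ / 2 := by unfold θ; field_simp
  obtain ⟨δ, hδ, huc⟩ := Metric.uniformContinuousOn_iff_le.1
    ((isCompact_closedBall (0 : Params C ι ks) (R + ρ)).uniformContinuousOn_of_continuous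
      (continuous_maxSpecNorm ks).continuousOn) (θ * τ) (by positivity)
  refine ⟨min δ (ρ / 2), by positivity, fun W hτW hWR => ⟨(1 + θ) • W, fun W' hW' => ?_⟩⟩
  have hWnorm : ‖W‖ ≤ R := (norm_le_maxSpecNorm ks W).trans hWR
  have hcenter : dist ((1 + θ) • W) W ≤ ρ / 2 := by
    rw [add_smul, one_smul, dist_self_add_left, norm_smul, Real.norm_of_nonneg hθ.le]
    exact (mul_le_mul_of_nonneg_left hWnorm hθ.le).trans hθR
  have hWW' : dist W' W ≤ ρ := by
    linarith [dist_triangle W' ((1 + θ) • W) W,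
      (Metric.mem_closedBall.1 hW').trans (min_le_right _ _)]
  have hnorm : ∀ U : Params C ι ks, dist U W ≤ ρ → U ∈ Metric.closedBall 0 (R + ρ) := fun U hU => by
    rw [mem_closedBall_zero_iff]
    linarith [norm_le_norm_add_norm_sub' U W, dist_eq_norm U W]
  have hclose := huc W' (hnorm W' hWW') ((1 + θ) • W) (hnorm _ (hcenter.trans (by linarith)))
    (hW'.trans (min_le_left _ _))
  rw [maxSpecNorm_smul (by positivity), Real.dist_eq] at hclose
  refine ⟨hWW', ?_⟩
  have := mul_le_mul_of_nonneg_left hτW.le hθ.le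
  have := (abs_le.1 hclose).1
  change maxSpecNorm ks W ≤ maxSpecNorm ks W'
  linarith

end Params

/-! ### The prior variance -/

theorem one_le_maxWidth {ks : List ℕ} (hks : ks ≠ []) (hpos : ∀ k ∈ ks, 0 < k) :
    1 ≤ maxWidth ks := by
  cases ks with
  | nil => exact absurd rfl hks
  | cons k ks => exact (hpos k List.mem_cons_self).trans_le (le_max_left k (maxWidth ks))

theorem depth_ne_zero (ks : List ℕ) : depth ks ≠ 0 := Nat.succ_ne_zero _

theorem log_two_mul_maxWidth_mul_depth_nonneg {ks : List ℕ} (hks : 1 ≤ maxWidth ks) :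
    0 ≤ Real.log (2 * maxWidth ks * depth ks) := by
  refine Real.log_nonneg ?_
  exact_mod_cast Nat.mul_pos (Nat.mul_pos two_pos hks) (Nat.pos_of_ne_zero (depth_ne_zero ks))

theorem rpow_two_div_depth (ks : List ℕ) {x : ℝ} (hx : 0 ≤ x) :
    (x ^ depth ks) ^ (2 / (depth ks : ℝ)) = x ^ 2 := by
  have hL : (depth ks : ℝ) ≠ 0 := Nat.cast_ne_zero.2 (depth_ne_zero ks)
  rw [← Real.rpow_natCast_mul hx, mul_div_cancel₀ _ hL, Real.rpow_two]

namespace CSBM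

variable {d C : ℕ} {σ : ℝ} (M : CSBM d C σ) (e : M.Test) {ks : List ℕ} {γ α B κ v : ℝ}
  {W : Params C (Fin d ⊕ Fin d) ks}

theorem dist_pos_of_lt (hγ : 0 < γ) (hW : γ / 8 < Params.maxSpecNorm ks W ^ depth ks * M.dist e) :
    0 < M.dist e :=
  pos_of_mul_pos_right ((by positivity : 0 < γ / 8).trans hW)
    (pow_nonneg (Params.maxSpecNorm_nonneg ks W) _)

theorem rpow_lt_maxSpecNorm (hγ : 0 < γ)
    (hW : γ / 8 < Params.maxSpecNorm ks W ^ depth ks * M.dist e) :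
    (γ / (16 * M.maxNorm e)) ^ (depth ks : ℝ)⁻¹ < Params.maxSpecNorm ks W := by
  have hε := M.dist_pos_of_lt e hγ hW
  have hεB := M.dist_le_two_mul_maxNorm e
  have hB : 0 < M.maxNorm e := by linarith
  have hT := Params.maxSpecNorm_nonneg ks W
  refine lt_of_pow_lt_pow_left₀ (depth ks) hT ?_
  rw [Real.rpow_inv_natCast_pow (by positivity) (depth_ne_zero ks), div_lt_iff₀ (by positivity)]
  have := mul_le_mul_of_nonneg_left hεB (pow_nonneg hT (depth ks))
  linarith

theorem priorVarBound_eq (ks : List ℕ) (γ α : ℝ) :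
    M.priorVarBound e ks γ α = (γ / (8 * M.dist e)) ^ (2 / (depth ks : ℝ)) /
      (2 * maxWidth ks * ((M.train.size : ℝ) ^ α + Real.log (2 * maxWidth ks * depth ks))) := by
  rw [priorVarBound, ← Real.rpow_add M.train.size_pos]
  ring_nf

theorem one_le_size_rpow (hα : 0 ≤ α) : 1 ≤ (M.train.size : ℝ) ^ α :=
  Real.one_le_rpow (Nat.one_le_cast.2 Fintype.card_pos) hα

theorem priorVarBound_le_maxSpecNorm_sq (hks : 1 ≤ maxWidth ks) (hγ : 0 < γ) (hα : 0 ≤ α)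
    (hW : γ / 8 < Params.maxSpecNorm ks W ^ depth ks * M.dist e) :
    M.priorVarBound e ks γ α ≤ Params.maxSpecNorm ks W ^ 2 := by
  have hε := M.dist_pos_of_lt e hγ hW
  have hb : (1 : ℝ) ≤ maxWidth ks := Nat.one_le_cast.2 hks
  have hone : 1 ≤ 2 * maxWidth ks *
      ((M.train.size : ℝ) ^ α + Real.log (2 * maxWidth ks * depth ks)) :=
    one_le_mul_of_one_le_of_one_le (by linarith)
      (by linarith [M.one_le_size_rpow hα, log_two_mul_maxWidth_mul_depth_nonneg hks])
  have hquot : γ / (8 * M.dist e) ≤ Params.maxSpecNorm ks W ^ depth ks := by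
    rw [div_le_iff₀ (by positivity)]
    linarith
  calc M.priorVarBound e ks γ α ≤ (γ / (8 * M.dist e)) ^ (2 / (depth ks : ℝ)) := by
        rw [priorVarBound_eq]
        exact div_le_self (by positivity) hone
    _ ≤ (Params.maxSpecNorm ks W ^ depth ks) ^ (2 / (depth ks : ℝ)) :=
        Real.rpow_le_rpow (by positivity) hquot (by positivity)
    _ = Params.maxSpecNorm ks W ^ 2 := rpow_two_div_depth ks (Params.maxSpecNorm_nonneg ks W)

/-- The factor of `N ^ (-α)` in a lower bound of `priorVarBound` that depends on the model only
through the largest norm `B` of an aggregated feature. -/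
def priorVarFactor (ks : List ℕ) (γ B : ℝ) : ℝ :=
  (γ / (16 * B)) ^ (2 / (depth ks : ℝ)) /
    (2 * maxWidth ks * (1 + Real.log (2 * maxWidth ks * depth ks)))

theorem priorVarFactor_pos (hks : 1 ≤ maxWidth ks) (hγ : 0 < γ) (hB : 0 < B) :
    0 < priorVarFactor ks γ B := by
  have hlog := log_two_mul_maxWidth_mul_depth_nonneg hks
  have : (0 : ℝ) < maxWidth ks := Nat.cast_pos.2 hks
  unfold priorVarFactor
  positivity

theorem priorVarFactor_div_le_priorVarBound (hks : 1 ≤ maxWidth ks) (hγ : 0 < γ) (hα : 0 ≤ α)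
    (hε : 0 < M.dist e) :
    priorVarFactor ks γ (M.maxNorm e) / (M.train.size : ℝ) ^ α ≤ M.priorVarBound e ks γ α := by
  have hεB := M.dist_le_two_mul_maxNorm e
  have hB : 0 < M.maxNorm e := by linarith
  have hlog := log_two_mul_maxWidth_mul_depth_nonneg hks
  have : (0 : ℝ) < maxWidth ks := Nat.cast_pos.2 hks
  have hN := M.one_le_size_rpow hα
  rw [priorVarBound_eq, priorVarFactor, div_div, mul_assoc (2 * _)]
  gcongr ?_ ^ _ / (_ * ?_)
  · exact div_le_div_of_nonneg_left hγ.le (by positivity) (by linarith)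
  · rw [one_add_mul]
    exact add_le_add_right (le_mul_of_one_le_right hlog hN) _

theorem one_div_le_of_mul_priorVarBound_le (hks : 1 ≤ maxWidth ks) (hγ : 0 < γ) (hα : 0 ≤ α)
    (hε : 0 < M.dist e) (hκ : 0 < κ) (hv : κ * M.priorVarBound e ks γ α ≤ v) :
    0 < v ∧ 1 / v ≤ (κ * priorVarFactor ks γ (M.maxNorm e))⁻¹ * (M.train.size : ℝ) ^ α := by
  have hB : 0 < M.maxNorm e := by linarith [M.dist_le_two_mul_maxNorm e]
  have hfactor := priorVarFactor_pos hks hγ hB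
  have hN : 0 < (M.train.size : ℝ) ^ α := one_pos.trans_le (M.one_le_size_rpow hα)
  have hlow : κ * priorVarFactor ks γ (M.maxNorm e) / (M.train.size : ℝ) ^ α ≤ v := by
    rw [mul_div_assoc]
    exact (mul_le_mul_of_nonneg_left
      (M.priorVarFactor_div_le_priorVarBound e hks hγ hα hε) hκ.le).trans hv
  have hlow0 : 0 < κ * priorVarFactor ks γ (M.maxNorm e) / (M.train.size : ℝ) ^ α := by positivity
  refine ⟨hlow0.trans_le hlow, (one_div_le_one_div_of_le hlow0 hlow).trans_eq ?_⟩
  rw [one_div_div, div_eq_inv_mul]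

end CSBM

/-! ### Perceptrons with large weights -/

theorem exists_mem_notMem_of_cond_real_lt {Ω : Type*} [MeasurableSpace Ω] {P : Measure Ω}
    [IsProbabilityMeasure P] {S A Q : Set Ω} (hQ : MeasurableSet Q) (hQS : Q ⊆ S)
    (h : (cond P S).real A < P.real Q) : ∃ x ∈ Q, x ∉ A := by
  refine Set.not_subset.1 fun hQA => h.not_ge ?_
  have hcond : P Q ≤ cond P S Q := by
    rw [cond_apply' hQ, Set.inter_eq_right.2 hQS]
    exact le_mul_of_one_le_left' (ENNReal.one_le_inv.2 prob_le_one)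
  exact (ENNReal.toReal_mono (measure_ne_top _ _) hcond).trans (measureReal_mono hQA)

namespace CSBM

open Filter

variable {d C : ℕ} {σ : ℝ} {ks : List ℕ} {γ α B H κ : ℝ}

theorem eventually_exists_dist_le_of_concentrated (hB : 0 < B) (hks : 1 ≤ maxWidth ks)
    (hγ : 0 < γ) (hα : 0 < α) (hκ : 0 < κ) {R ρ : ℝ} (hR : 0 < R) (hρ : 0 < ρ) :
    ∀ᶠ N : ℕ in atTop, ∀ (M : CSBM d C σ) (e : M.Test), M.train.size = N → M.maxNorm e = B →
      M.Concentrated e ks γ α H κ → ∀ W : Params C (Fin d ⊕ Fin d) ks,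
        Params.maxSpecNorm ks W ≤ R → γ / 8 < Params.maxSpecNorm ks W ^ depth ks * M.dist e →
        ∃ W' ∈ Metric.closedBall W ρ, M.expLoss (M.test e) ks (γ / 4) W' ≤
          M.expLoss M.train ks (γ / 2) W' + ((N : ℝ) ^ (-α) + H * C * M.dist e) := by
  obtain ⟨r, hr, hball⟩ := Params.exists_closedBall_subset (C := C) (ι := Fin d ⊕ Fin d) ks
    hR.le hρ (by positivity : 0 < (γ / (16 * B)) ^ (depth ks : ℝ)⁻¹)
  filter_upwards [Params.eventually_exp_neg_rpow_lt_gaussian_closedBall (C := C)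
    (ι := Fin d ⊕ Fin d) ks (R + ρ) (κ * priorVarFactor ks γ B)⁻¹ (pow_pos hR 2) hr hα]
    with N hN M e hMN hMB ⟨v, hvlow, hvup, hv⟩ W hWR hW
  subst hMN hMB
  obtain ⟨W₁, hW₁⟩ := hball W (M.rpow_lt_maxSpecNorm e hγ hW) hWR
  have hW₁R : ‖W₁‖ ≤ R + ρ := by
    have hW₁W := norm_le_of_mem_closedBall (hW₁ (Metric.mem_closedBall_self hr.le)).1
    linarith [Params.norm_le_maxSpecNorm ks W]
  have hlarge : Metric.closedBall W₁ r ⊆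
      {W' | γ / 8 < Params.maxSpecNorm ks W' ^ depth ks * M.dist e} := fun W' hW' =>
    hW.trans_le (mul_le_mul_of_nonneg_right
      (pow_le_pow_left₀ (Params.maxSpecNorm_nonneg ks W) (hW₁ hW').2 _) (M.dist_nonneg e))
  obtain ⟨hv0, hvinv⟩ := M.one_div_le_of_mul_priorVarBound_le e hks hγ hα.le
    (M.dist_pos_of_lt e hγ hW) hκ hvlow
  have hvR : v ≤ R ^ 2 := (hvup.trans (M.priorVarBound_le_maxSpecNorm_sq e hks hγ hα.le hW)).trans
    (pow_le_pow_left₀ (Params.maxSpecNorm_nonneg ks W) hWR 2)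
  have hvcoe := Real.coe_toNNReal v hv0.le
  obtain ⟨W', hW'mem, hW'⟩ := exists_mem_notMem_of_cond_real_lt
    Metric.isClosed_closedBall.measurableSet hlarge
    (hv.trans_lt (hN v.toNNReal (Real.toNNReal_pos.2 hv0).ne' (hvcoe.trans_le hvR)
      (by rwa [hvcoe]) W₁ hW₁R))
  rw [Set.mem_ofPred_eq, not_lt, sub_le_iff_le_add'] at hW'
  exact ⟨W', (hW₁ hW'mem).1, hW'⟩

theorem eventually_expLoss_test_le_of_concentrated (hB : 0 < B)
    (hks : 1 ≤ maxWidth ks) (hγ : 0 < γ) (hα : 0 < α) (hκ : 0 < κ) (R : ℝ) :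
    ∀ᶠ N : ℕ in atTop, ∀ (M : CSBM d C σ) (e : M.Test), M.train.size = N → M.maxNorm e = B →
      M.Concentrated e ks γ α H κ → ∀ W : Params C (Fin d ⊕ Fin d) ks,
        Params.maxSpecNorm ks W ≤ R → γ / 8 < Params.maxSpecNorm ks W ^ depth ks * M.dist e →
        M.expLoss (M.test e) ks 0 W ≤
          M.expLoss M.train ks (3 * γ / 4) W + ((N : ℝ) ^ (-α) + H * C * M.dist e) := by
  obtain ⟨ρ, hρ, hclose⟩ := exists_forall_abs_logits_sub_le (d := d) (C := C) ks (max R 1 + 1) B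
    (by positivity : 0 < γ / 8)
  filter_upwards [eventually_exists_dist_le_of_concentrated (d := d) (C := C) (σ := σ) (H := H)
    hB hks hγ hα hκ (by positivity : 0 < max R 1) (lt_min hρ one_pos)]
    with N hN M e hMN hMB hconc W hWR hW
  obtain ⟨W', hW'mem, hW'⟩ := hN M e hMN hMB hconc W (hWR.trans (le_max_left _ _)) hW
  subst hMB
  have hWnorm : ‖W‖ ≤ max R 1 :=
    (Params.norm_le_maxSpecNorm ks W).trans (hWR.trans (le_max_left _ _))
  have hW'norm : ‖W'‖ ≤ max R 1 + 1 := by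
    linarith [norm_le_of_mem_closedBall hW'mem, min_le_right ρ 1]
  have hlogits := hclose W' W hW'norm (hWnorm.trans (by linarith))
    ((Metric.mem_closedBall.1 hW'mem).trans (min_le_left _ _))
  have htest : M.expLoss (M.test e) ks 0 W ≤ M.expLoss (M.test e) ks (γ / 4) W' :=
    M.expLoss_le_expLoss _ (fun j c => abs_sub_comm (logits (M.test e) ks W' j c) _ ▸
      hlogits _ j (M.norm_agg_test_le_maxNorm e j) c) (by linarith)
  have htrain : M.expLoss M.train ks (γ / 2) W' ≤ M.expLoss M.train ks (3 * γ / 4) W :=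
    M.expLoss_le_expLoss _ (fun i => hlogits _ i (M.norm_agg_train_le_maxNorm e i)) (by linarith)
  linarith

end CSBM

/-! ### The generalization bound -/

namespace CSBM

open Filter

section Terms

variable {d C : ℕ} {σ : ℝ} (M : CSBM d C σ) (e : M.Test) {ks : List ℕ} {γ : ℝ} (α : ℝ)

theorem termD_nonneg (hγ : 0 < γ) (W : Params C (Fin d ⊕ Fin d) ks) : 0 ≤ M.termD e ks γ α W := by
  have hε := M.dist_nonneg e
  have hF := Params.sumFrobSq_nonneg ks W
  unfold termD
  positivity

theorem rpow_neg_le_termD (hks : 1 ≤ maxWidth ks) (hγ : 0 < γ)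
    {W : Params C (Fin d ⊕ Fin d) ks}
    (hW : γ / 8 < Params.maxSpecNorm ks W ^ depth ks * M.dist e) :
    (M.train.size : ℝ) ^ (-α) ≤ M.termD e ks γ α W := by
  have hε := M.dist_nonneg e
  have hT := Params.maxSpecNorm_nonneg ks W
  have hb : (1 : ℝ) ≤ maxWidth ks := Nat.one_le_cast.2 hks
  have hN : 0 < (M.train.size : ℝ) ^ α := Real.rpow_pos_of_pos M.train.size_pos α
  have hγε : (γ / 8) ^ (2 / (depth ks : ℝ)) ≤
      maxWidth ks * Params.sumFrobSq ks W * M.dist e ^ (2 / (depth ks : ℝ)) :=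
    calc (γ / 8) ^ (2 / (depth ks : ℝ))
        ≤ (Params.maxSpecNorm ks W ^ depth ks * M.dist e) ^ (2 / (depth ks : ℝ)) := by gcongr
      _ = Params.maxSpecNorm ks W ^ 2 * M.dist e ^ (2 / (depth ks : ℝ)) := by
        rw [Real.mul_rpow (by positivity) hε, rpow_two_div_depth ks hT]
      _ ≤ maxWidth ks * Params.sumFrobSq ks W * M.dist e ^ (2 / (depth ks : ℝ)) := by
        gcongr
        exact (Params.maxSpecNorm_sq_le_sumFrobSq ks W).trans
          (le_mul_of_one_le_left (Params.sumFrobSq_nonneg ks W) hb)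
  rw [termD, Real.rpow_neg M.train.size_pos.le, div_mul_eq_mul_div, le_div_iff₀ (by positivity),
    mul_left_comm, inv_mul_cancel₀ hN.ne', mul_one]
  exact hγε

theorem dist_le_sq_mul_termA (hC : 2 ≤ C) (hσ : 0 < σ) : M.dist e ≤ σ ^ 2 * M.termA e :=
  calc M.dist e ≤ σ ^ 2 * (2 / σ ^ 2 * M.dist e) := by
        rw [← mul_assoc, mul_div_cancel₀ _ (by positivity)]
        linarith [M.dist_nonneg e]
    _ ≤ σ ^ 2 * M.termA e :=
        mul_le_mul_of_nonneg_left (M.two_div_sq_mul_dist_le_termA e hC) (sq_nonneg σ)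

end Terms

/-- The constant `K` of the generalization bound: perceptrons with small weights contribute
`discrepancyConst B`, those with large weights `H * C * σ ^ 2`, and the terms (d) and `const` have
coefficient `1`. -/
def generalizationConst (C : ℕ) (σ B H : ℝ) : ℝ := discrepancyConst B + H * C * σ ^ 2 + 1

variable {d C : ℕ} {σ : ℝ} {ks : List ℕ} {γ α B H κ : ℝ}

theorem discrepancyConst_le_generalizationConst (hH : 0 ≤ H) :
    discrepancyConst B ≤ generalizationConst C σ B H := by
  rw [generalizationConst, add_assoc]
  exact le_add_of_nonneg_right (by positivity)

theorem mul_sq_le_generalizationConst (hB : 0 ≤ B) :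
    H * C * σ ^ 2 ≤ generalizationConst C σ B H := by
  have := discrepancyConst_nonneg hB
  unfold generalizationConst
  linarith

theorem one_le_generalizationConst (hB : 0 ≤ B) (hH : 0 ≤ H) :
    1 ≤ generalizationConst C σ B H :=
  le_add_of_nonneg_left (add_nonneg (discrepancyConst_nonneg hB) (by positivity))

theorem eventually_expLoss_test_le (hC : 2 ≤ C) (hσ : 0 < σ) (hB : 0 < B) (hH : 0 ≤ H)
    (hks : 1 ≤ maxWidth ks) (hγ : 0 < γ) (hα : 0 < α) (hκ : 0 < κ) (R : ℝ) :
    ∀ᶠ N : ℕ in atTop, ∀ (M : CSBM d C σ) (e : M.Test) (s : ℕ), M.train.size = N →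
      M.maxNorm e = B → M.NearSets e s → M.Concentrated e ks γ α H κ →
      ∀ W : Params C (Fin d ⊕ Fin d) ks, Params.maxSpecNorm ks W ≤ R →
        M.expLoss (M.test e) ks 0 W ≤ M.expLoss M.train ks (3 * γ / 4) W +
          generalizationConst C σ B H *
            (M.termA e + M.termB e + M.termC e s + M.termD e ks γ α W) := by
  filter_upwards [eventually_expLoss_test_le_of_concentrated (d := d) (C := C) (σ := σ) (H := H)
    hB hks hγ hα hκ R] with N hN M e s hMN hMB hs hconc W hWR
  have hA := M.termA_nonneg e
  have hB' := M.termB_nonneg e hC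
  have hC' := M.termC_nonneg e s
  have hD := M.termD_nonneg e α hγ W
  have hK := one_le_generalizationConst (C := C) (σ := σ) hB.le hH
  rcases le_or_gt (Params.maxSpecNorm ks W ^ depth ks * M.dist e) (γ / 8) with hW | hW
  · subst hMB
    exact (M.expLoss_test_le e hC hσ hB hs hW
      (by linarith : 0 + 2 * (γ / 8) ≤ 3 * γ / 4)).trans (add_le_add_right (mul_le_mul
        (discrepancyConst_le_generalizationConst hH) (by linarith) (by positivity) (by linarith)) _)
  · subst hMN
    refine (hN M e rfl hMB hconc W hWR hW).trans (add_le_add_right ?_ _)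
    calc (M.train.size : ℝ) ^ (-α) + H * C * M.dist e
        ≤ M.termD e ks γ α W + H * C * (σ ^ 2 * M.termA e) :=
          add_le_add (M.rpow_neg_le_termD e α hks hγ hW)
            (mul_le_mul_of_nonneg_left (M.dist_le_sq_mul_termA e hC hσ) (by positivity))
      _ = 1 * M.termD e ks γ α W + H * C * σ ^ 2 * M.termA e := by ring
      _ ≤ generalizationConst C σ B H * M.termD e ks γ α W +
          generalizationConst C σ B H * M.termA e := by
          gcongr
          exact mul_sq_le_generalizationConst hB.le
      _ = generalizationConst C σ B H * (M.termA e + M.termD e ks γ α W) := by ring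
      _ ≤ _ := mul_le_mul_of_nonneg_left (by linarith) (by linarith)

theorem eventually_mul_one_div_le {δ l : ℝ} (hα : α < 1 / 4) (hδ : 0 < δ) (hl : 0 < l) (n : ℕ) :
    ∀ᶠ N : ℕ in atTop, n * (1 / (4 * N * (1 / (N : ℝ) ^ (2 * α) * l) ^ 2)) ≤ δ := by
  filter_upwards [eventually_atTop_natCast_rpow (by linarith : 0 < 1 - 4 * α)
    (eventually_ge_atTop (n / (4 * l ^ 2 * δ))), eventually_gt_atTop 0] with N hN hN0
  have hN0' : (0 : ℝ) < N := Nat.cast_pos.2 hN0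
  have hsplit : (N : ℝ) ^ (1 - 4 * α) = N / ((N : ℝ) ^ (2 * α)) ^ 2 := by
    rw [Real.rpow_sub hN0', Real.rpow_one, ← Real.rpow_mul_natCast hN0'.le]
    ring_nf
  rw [hsplit, div_le_iff₀ (by positivity)] at hN
  rw [mul_one_div, div_le_iff₀ (by positivity)]
  refine hN.trans_eq ?_
  field_simp

theorem eventually_le_labelLaw_forall_expLoss_test_le {δ : ℝ} (hC : 2 ≤ C) (hσ : 0 < σ)
    (hB : 0 < B) (hH : 0 ≤ H) (hks : 1 ≤ maxWidth ks) (hγ : 0 < γ) (hα : 0 < α) (hα' : α < 1 / 4)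
    (hκ : 0 < κ) (hδ : 0 < δ) (hlog : 1 < logArg C ks B γ δ) (R : ℝ) :
    ∀ᶠ N : ℕ in atTop, ∀ (M : CSBM d C σ) (e : M.Test) (s : ℕ), M.train.size = N →
      M.maxNorm e = B → M.NearSets e s → M.Concentrated e ks γ α H κ →
      1 - δ ≤ (M.labelLaw M.train).real {y | ∀ W : Params C (Fin d ⊕ Fin d) ks,
        Params.maxSpecNorm ks W ≤ R → M.expLoss (M.test e) ks 0 W ≤ empLoss M.train ks γ W y +
          generalizationConst C σ B H * (M.termA e + M.termB e + M.termC e s +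
            M.termD e ks γ α W + M.termConst e ks γ α δ)} := by
  have hl := Real.log_pos hlog
  obtain ⟨n, hn⟩ := exists_le_labelLaw_forall (σ := σ) d (two_pos.trans_le hC) hσ ks R B
    (by linarith : 3 * γ / 4 < γ)
  filter_upwards [eventually_expLoss_test_le (d := d) hC hσ hB hH hks hγ hα hκ R,
    eventually_mul_one_div_le hα' hδ hl n] with N hN hfail M e s hMN hMB hs hconc
  have := M.isProbabilityMeasure_labelLaw M.train (two_pos.trans_le hC) hσ
  have hNpos := M.train.size_pos
  have htest := hN M e s hMN hMB hs hconc
  subst hMN hMB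
  set t := 1 / (M.train.size : ℝ) ^ (2 * α) * Real.log (logArg C ks (M.maxNorm e) γ δ)
  have ht : 0 < t := by positivity
  have htconst : t ≤ M.termConst e ks γ α δ := le_add_of_nonneg_left (by positivity)
  have hK : t ≤ generalizationConst C σ (M.maxNorm e) H * M.termConst e ks γ α δ :=
    htconst.trans
      (le_mul_of_one_le_left (ht.le.trans htconst) (one_le_generalizationConst hB.le hH))
  refine (by linarith : 1 - δ ≤ 1 - n * (1 / (4 * M.train.size * t ^ 2))).trans
    ((hn M M.train (M.norm_agg_train_le_maxNorm e) t ht).trans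
      (measureReal_mono fun y hy W hWR => ?_))
  have := htest W hWR
  have := hy W hWR
  rw [mul_add]
  linarith

end CSBM

end SubgroupOOD

end

theorem theorem3 (C : ℕ) (hC : 2 ≤ C) (σ B H κ : ℝ) (hσ : 0 < σ) (hB : 0 < B) (hH : 0 ≤ H)
    (hκ : 0 < κ) (hκ1 : κ ≤ 1) :
    ∃ K : ℝ, 0 < K ∧
      ∀ (d : ℕ) (ks : List ℕ), ks ≠ [] → (∀ k ∈ ks, 0 < k) → ∀ γ : ℝ, 0 < γ →
        -- the bound of the expected loss discrepancy
        (∀ (M : SubgroupOOD.CSBM d C σ) (e : M.Test) (s : ℕ),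
          M.maxNorm e = B → M.NearSets e s →
          ∀ (lam : ℝ), 0 < lam →
          ∀ P : MeasureTheory.Measure (SubgroupOOD.Params C (Fin d ⊕ Fin d) ks),
            MeasureTheory.IsProbabilityMeasure P →
            (∀ᵐ W ∂P, SubgroupOOD.Params.maxSpecNorm ks W ^ SubgroupOOD.depth ks * M.dist e
              ≤ γ / 8) →
            M.discrepancy e ks (γ / 2) lam P
              ≤ lam * (K * (M.termA e + M.termB e + M.termC e s))) ∧
        -- the generalization bound
        (∀ α : ℝ, 0 < α → α < 1 / 4 → ∀ δ : ℝ, 0 < δ → δ < 1 →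
          1 < SubgroupOOD.CSBM.logArg C ks B γ δ →
          ∀ R : ℝ, ∃ N₀ : ℕ, ∀ (M : SubgroupOOD.CSBM d C σ) (e : M.Test) (s : ℕ),
            N₀ ≤ M.train.size → M.maxNorm e = B → M.NearSets e s →
            M.Concentrated e ks γ α H κ →
            1 - δ ≤ (M.labelLaw M.train).real
              {y | ∀ W : SubgroupOOD.Params C (Fin d ⊕ Fin d) ks,
                SubgroupOOD.Params.maxSpecNorm ks W ≤ R →
                M.expLoss (M.test e) ks 0 W ≤ SubgroupOOD.empLoss M.train ks γ W y +
                  K * (M.termA e + M.termB e + M.termC e s + M.termD e ks γ α W +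
                    M.termConst e ks γ α δ)}) := by
  refine ⟨SubgroupOOD.CSBM.generalizationConst C σ B H,
    one_pos.trans_le (SubgroupOOD.CSBM.one_le_generalizationConst hB.le hH),
    fun d ks hks hpos γ hγ => ⟨?_, ?_⟩⟩
  · intro M e s hMB hs lam hlam P _ hP
    have hterms : 0 ≤ M.termA e + M.termB e + M.termC e s :=
      add_nonneg (add_nonneg (M.termA_nonneg e) (M.termB_nonneg e hC)) (M.termC_nonneg e s)
    refine (M.discrepancy_le e hC hσ (hMB ▸ hB) hs hlam.le
      (hP.mono fun W hW => hW.trans_eq (by ring : γ / 8 = γ / 2 / 4))).trans ?_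
    rw [hMB]
    gcongr
    exact SubgroupOOD.CSBM.discrepancyConst_le_generalizationConst hH
  · intro α hα hα' δ hδ _ hlog R
    obtain ⟨N₀, hN₀⟩ := Filter.eventually_atTop.1
      (SubgroupOOD.CSBM.eventually_le_labelLaw_forall_expLoss_test_le (d := d) (σ := σ) (H := H)
        hC hσ hB hH (SubgroupOOD.one_le_maxWidth hks hpos) hγ hα hα' hκ hδ hlog R)
    exact ⟨N₀, fun M e s hN => hN₀ _ hN M e s rfl⟩
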